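/- Let $M$ be a smooth manifold (Hausdorff, second countable) of dimension $2n+1$ with a paracontact metric structure $(\varphi,\xi,\eta,g)$: $\varphi$ is a smooth $(1,1)$-tensor field, $\xi$ a smooth vector field, $\eta$ a smooth $1$-form and $g$ a semi-Riemannian metric such that $\eta(\xi)=1$, $\varphi^2=I-\eta\otimes\xi$, the eigendistributions of $\varphi$ for the eigenvalues $1$ and $-1$ have dimension $n$, $g(\varphi X,\varphi Y)=-g(X,Y)+\eta(X)\eta(Y)$ and $d\eta(X,Y)=g(X,\varphi Y)$, where $2\,d\eta(X,Y)=X\eta(Y)-Y\eta(X)-\eta([X,Y])$. Put $h=\frac12 L_\xi\varphi$, and let $R(X,Y)=[\nabla_X,\nabla_Y]-\nabla_{[X,Y]}$ be the curvature of the Levi-Civita connection of $g$. Suppose that $M$ is a $(-1,\mu)$-space, that is, for some real constant $\mu$ and all vector fields $X,Y$, $$R(X,Y)\xi=-(\eta(Y)X-\eta(X)Y)+\mu(\eta(Y)hX-\eta(X)hY).$$ Then one of the following holds. 1. $h=0$ and $M$ is paraSasakian, that is, $\varphi^2[X,Y]+[\varphi X,\varphi Y]-\varphi[\varphi X,Y]-\varphi[X,\varphi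 Y]=2\,d\eta(X,Y)\,\xi$ for all vector fields $X,Y$. 2. $h\neq0$, and $\operatorname{rank}(h_p)\in\{1,\ldots,n\}$ at every $p\in M$ where $h_p\neq0$. Moreover, for every $p\in M$ there is a basis $\{\xi_p,X_1,Y_1,\ldots,X_n,Y_n\}$ of $T_pM$ such that (a) the only non-vanishing components of $g_p$ are $g_p(\xi,\xi)=1$ and $g_p(X_i,Y_i)=\pm1$ (with a sign that may depend on $i$); (b) for each $i$, either $h_pX_i=Y_i$ and $h_pY_i=0$, or $h_pX_i=h_pY_i=0$; that is, $h_p|_{\langle X_i,Y_i\rangle}$ is $\begin{pmatrix}0&0\\1&0\end{pmatrix}$ or $0$. The first type occurs for exactly $\operatorname{rank}(h_p)$ indices $i$. If moreover $n=1$ in case 2, then every such basis $\{\xi_p,X_1,Y_1\}$, at any $p\in M$, satisfies either $\varphi X_1=X_1$ and $\varphi Y_1=-Y_1$, or $\varphi X_1=-X_1$ and $\varphi Y_1=Y_1$; and where $h_p\neq0$ it satisfies $h_p\xi_p=0$, $h_pX_1=Y_1$ and $h_pY_1=0$. -/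

import Mathlib

open Bundle Module VectorField
open scoped Manifold ContDiff

noncomputable section

namespace ParacontactGeometry

section LeviCivita

variable {E : Type*} [NormedAddCommGroup E] [NormedSpace ℝ E] [FiniteDimensional ℝ E]
  {H : Type*} [TopologicalSpace H] {I : ModelWithCorners ℝ E H}
  {M : Type*} [TopologicalSpace M] [ChartedSpace H M] [IsManifold I ∞ M]

set_option linter.unusedSectionVars false

variable (I M) in
/-- A smooth semi-Riemannian metric on a smooth manifold `M`: a smooth field of
symmetric nondegenerate bilinear forms on the tangent spaces. -/
structure SemiRiemannianMetric where
  /-- The bilinear form on each tangent space. -/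
  inner (x : M) : TangentSpace I x →L[ℝ] TangentSpace I x →L[ℝ] ℝ
  symm (x : M) (v w : TangentSpace I x) : inner x v w = inner x w v
  nondegenerate (x : M) (v : TangentSpace I x) (hv : ∀ w, inner x v w = 0) : v = 0
  contMDiff : ContMDiff I (I.prod 𝓘(ℝ, E →L[ℝ]
      E →L[ℝ] ℝ)) ∞
    (fun x ↦ TotalSpace.mk' (E →L[ℝ] E →L[ℝ] ℝ)
      x (inner x))

variable (g : SemiRiemannianMetric I M) {X X' Y Y' Z Z' : Π x : M, TangentSpace I x}
  {x : M}

lemma SemiRiemannianMetric.mdifferentiableAt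
    (hX : MDiffAt (T% X) x) (hY : MDiffAt (T% Y) x) :
    MDiffAt (fun y ↦ g.inner y (X y) (Y y)) x := by
  have : MDifferentiableAt I (I.prod 𝓘(ℝ))
      (fun y ↦ TotalSpace.mk' ℝ (E := Bundle.Trivial M ℝ) y (g.inner y (X y) (Y y))) x := by
    apply MDifferentiableAt.clm_bundle_apply₂ (F₁ := E)
      (F₂ := E)
    · exact g.contMDiff.mdifferentiableAt (by simp)
    · exact hX
    · exact hY
  simp only [mdifferentiableAt_totalSpace] at this
  exact this.2

/-- The right-hand side of the Koszul formula,
`X g(Y, Z) + Y g(Z, X) - Z g(X, Y) - g(X, [Y, Z]) + g(Y, [Z, X]) + g(Z, [X, Y])`,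
evaluated at `x`. -/
def koszul (X Y Z : Π x : M, TangentSpace I x) (x : M) : ℝ :=
  d% (fun y ↦ g.inner y (Y y) (Z y)) x (X x)
    + d% (fun y ↦ g.inner y (Z y) (X y)) x (Y x)
    - d% (fun y ↦ g.inner y (X y) (Y y)) x (Z x)
    - g.inner x (X x) (mlieBracket I Y Z x)
    + g.inner x (Y x) (mlieBracket I Z X x)
    + g.inner x (Z x) (mlieBracket I X Y x)

lemma koszul_tensorial_right (hX : MDiffAt (T% X) x) (hY : MDiffAt (T% Y) x) :
    TensorialAt I E (koszul g X Y · x) x where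
  smul {f Z} hf hZ := by
    have h1 := mvfderiv_fun_mul hf (g.mdifferentiableAt hY hZ)
    have h2 := mvfderiv_fun_mul hf (g.mdifferentiableAt hZ hX)
    simp only [koszul, Pi.smul_apply', map_smul, _root_.smul_apply, smul_eq_mul,
      mlieBracket_smul_right hf hZ, mlieBracket_smul_left hf hZ, map_add, map_neg, neg_smul] at *
    rw [h1, h2]
    simp [g.symm x (Z x)]
    ring
  add {Z Z'} hZ hZ' := by
    have h1 := mvfderiv_fun_add (g.mdifferentiableAt hY hZ) (g.mdifferentiableAt hY hZ')
    have h2 := mvfderiv_fun_add (g.mdifferentiableAt hZ hX) (g.mdifferentiableAt hZ' hX)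
    simp only [koszul, Pi.add_apply, map_add, _root_.add_apply,
      mlieBracket_add_right hZ hZ', mlieBracket_add_left hZ hZ'] at *
    rw [h1, h2]
    simp
    ring

lemma koszul_tensorial_left (hY : MDiffAt (T% Y) x) (hZ : MDiffAt (T% Z) x) :
    TensorialAt I E (koszul g · Y Z x) x where
  smul {f X} hf hX := by
    have h1 := mvfderiv_fun_mul hf (g.mdifferentiableAt hX hY)
    have h2 := mvfderiv_fun_mul hf (g.mdifferentiableAt hZ hX)
    simp only [koszul, Pi.smul_apply', map_smul, _root_.smul_apply, smul_eq_mul,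
      mlieBracket_smul_right hf hX, mlieBracket_smul_left hf hX, map_add, map_neg, neg_smul] at *
    rw [h1, h2]
    simp [g.symm x (Y x) (X x), g.symm x (Z x) (X x)]
    ring
  add {X X'} hX hX' := by
    have h1 := mvfderiv_fun_add (g.mdifferentiableAt hX hY) (g.mdifferentiableAt hX' hY)
    have h2 := mvfderiv_fun_add (g.mdifferentiableAt hZ hX) (g.mdifferentiableAt hZ hX')
    simp only [koszul, Pi.add_apply, map_add, _root_.add_apply,
      mlieBracket_add_right hX hX', mlieBracket_add_left hX hX'] at *
    rw [h1, h2]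
    simp
    ring

open scoped Classical in
/-- For a vector field `Y` that is differentiable at `x`, the bilinear form
`(X, Z) ↦ g(∇_X Y, Z)` on the tangent space at `x`, given by half of the Koszul expression
(and zero by convention if `Y` is not differentiable at `x`). -/
def koszulForm (Y : Π x : M, TangentSpace I x) (x : M) :
    TangentSpace I x →L[ℝ] TangentSpace I x →L[ℝ] ℝ :=
  if hY : MDiffAt (T% Y) x then
    (1 / 2 : ℝ) • TensorialAt.mkHom₂ (fun X Z ↦ koszul g X Y Z x) x
      (fun _ hZ ↦ koszul_tensorial_left g hY hZ) (fun _ hX ↦ koszul_tensorial_right g hX hY)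
  else 0

lemma koszulForm_apply (hX : MDiffAt (T% X) x) (hY : MDiffAt (T% Y) x) (hZ : MDiffAt (T% Z) x) :
    koszulForm g Y x (X x) (Z x) = 1 / 2 * koszul g X Y Z x := by
  simp only [koszulForm, dif_pos hY, _root_.smul_apply, smul_eq_mul]
  rw [TensorialAt.mkHom₂_apply _ _ hX hZ]

lemma SemiRiemannianMetric.isInvertible (x : M) : (g.inner x).IsInvertible := by
  have : FiniteDimensional ℝ (TangentSpace I x) := inferInstanceAs (FiniteDimensional ℝ E)
  have : T2Space (TangentSpace I x) := inferInstanceAs (T2Space E)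
  have hinj : Function.Injective (g.inner x).toLinearMap := by
    rw [← LinearMap.ker_eq_bot, LinearMap.ker_eq_bot']
    intro v hv
    exact g.nondegenerate x v fun w ↦ by
      have := congrArg (fun φ : TangentSpace I x →L[ℝ] ℝ ↦ φ w) hv
      simpa using this
  have hdim : finrank ℝ (TangentSpace I x) = finrank ℝ (TangentSpace I x →L[ℝ] ℝ) := by
    rw [← (LinearMap.toContinuousLinearMap (𝕜 := ℝ) (E := TangentSpace I x)
      (F' := ℝ)).finrank_eq]
    exact Subspace.dual_finrank_eq.symm
  exact ⟨(LinearMap.linearEquivOfInjective _ hinj hdim).toContinuousLinearEquiv, by ext; rfl⟩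

lemma koszulForm_ext {B : TangentSpace I x →L[ℝ] TangentSpace I x →L[ℝ] ℝ}
    (hY : MDiffAt (T% Y) x)
    (h : ∀ X Z : Π x : M, TangentSpace I x, MDiffAt (T% X) x → MDiffAt (T% Z) x →
      1 / 2 * koszul g X Y Z x = B (X x) (Z x)) : koszulForm g Y x = B := by
  ext v w
  have hv := FiberBundle.mdifferentiableAt_extend I E v
  have hw := FiberBundle.mdifferentiableAt_extend I E w
  have := koszulForm_apply g hv hY hw
  rw [h _ _ hv hw] at this
  simpa using this

/-- The Levi-Civita connection of a semi-Riemannian metric: `∇_X Y` is the vector field which the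
metric identifies with the one-form given by the Koszul formula. Here `leviCivita g Y x v`
is `∇_v Y`. -/
def leviCivita : CovariantDerivative I E (TangentSpace I : M → Type _) where
  toFun Y x := (g.inner x).inverse ∘L koszulForm g Y x
  isCovariantDerivativeOnUniv :=
    { add := by
        intro Y Y' x hY hY' _
        rw [← ContinuousLinearMap.comp_add]
        congr 1
        refine koszulForm_ext g (mdifferentiableAt_add_section hY hY') fun X Z hX hZ ↦ ?_
        rw [_root_.add_apply, _root_.add_apply, koszulForm_apply g hX hY hZ,
          koszulForm_apply g hX hY' hZ]
        have h1 := mvfderiv_fun_add (g.mdifferentiableAt hY hZ) (g.mdifferentiableAt hY' hZ)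
        have h2 := mvfderiv_fun_add (g.mdifferentiableAt hX hY) (g.mdifferentiableAt hX hY')
        simp only [koszul, Pi.add_apply, map_add, _root_.add_apply,
          mlieBracket_add_right hY hY', mlieBracket_add_left hY hY'] at *
        rw [h1, h2]
        simp
        ring
      leibniz := by
        intro Y f x hY hf _
        have key : koszulForm g (f • Y) x =
            f x • koszulForm g Y x + g.inner x ∘L (d% f x).smulRight (Y x) := by
          refine koszulForm_ext g (hf.smul_section hY) fun X Z hX hZ ↦ ?_
          have h1 := mvfderiv_fun_mul hf (g.mdifferentiableAt hY hZ)
          have h2 := mvfderiv_fun_mul hf (g.mdifferentiableAt hX hY)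
          simp only [koszul, koszulForm_apply g hX hY hZ, Pi.smul_apply', map_smul,
            _root_.smul_apply, _root_.add_apply, smul_eq_mul, mlieBracket_smul_right hf hY,
            mlieBracket_smul_left hf hY, map_add, map_neg, neg_smul] at *
          rw [h1, h2]
          simp [g.symm x (Z x) (Y x), g.symm x (X x) (Y x)]
          ring
        rw [key]
        ext v
        simp [(g.isInvertible x).inverse_apply_self] }

lemma inner_leviCivita (hX : MDiffAt (T% X) x) (hY : MDiffAt (T% Y) x) (hZ : MDiffAt (T% Z) x) :
    g.inner x (leviCivita g Y x (X x)) (Z x) = 1 / 2 * koszul g X Y Z x := by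
  rw [← koszulForm_apply g hX hY hZ]
  exact congrArg (fun φ : TangentSpace I x →L[ℝ] ℝ ↦ φ (Z x))
    ((g.isInvertible x).self_apply_inverse (koszulForm g Y x (X x)))

/-- The Levi-Civita connection is compatible with the metric. -/
lemma leviCivita_metric (hX : MDiffAt (T% X) x) (hY : MDiffAt (T% Y) x)
    (hZ : MDiffAt (T% Z) x) :
    d% (fun y ↦ g.inner y (Y y) (Z y)) x (X x) =
      g.inner x (leviCivita g Y x (X x)) (Z x) + g.inner x (Y x) (leviCivita g Z x (X x)) := by
  rw [g.symm x (Y x), inner_leviCivita g hX hY hZ, inner_leviCivita g hX hZ hY]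
  have h (A B : Π x : M, TangentSpace I x) : (fun y ↦ g.inner y (A y) (B y)) =
    fun y ↦ g.inner y (B y) (A y) := funext fun y ↦ g.symm ..
  simp only [koszul, h Z Y, h Z X, h Y X]
  rw [mlieBracket_swap_apply (V := Z) (W := Y), mlieBracket_swap_apply (V := Z) (W := X),
    mlieBracket_swap_apply (V := Y) (W := X)]
  simp only [map_neg]
  ring

/-- The Levi-Civita connection is torsion-free. -/
lemma leviCivita_torsion (hX : MDiffAt (T% X) x) (hY : MDiffAt (T% Y) x) :
    leviCivita g Y x (X x) - leviCivita g X x (Y x) = mlieBracket I X Y x := by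
  rw [← sub_eq_zero]
  refine g.nondegenerate x _ fun w ↦ ?_
  have hZ := FiberBundle.mdifferentiableAt_extend I E w
  set Z := FiberBundle.extend E w with hZdef
  have hw : w = Z x := by simp [hZdef]
  rw [hw]
  simp only [map_sub, _root_.sub_apply, inner_leviCivita g hX hY hZ, inner_leviCivita g hY hX hZ]
  have h (A B : Π x : M, TangentSpace I x) : (fun y ↦ g.inner y (A y) (B y)) =
    fun y ↦ g.inner y (B y) (A y) := funext fun y ↦ g.symm ..
  simp only [koszul, h Z Y, h Z X, h Y X]
  rw [mlieBracket_swap_apply (V := Z) (W := Y), mlieBracket_swap_apply (V := Z) (W := X),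
    mlieBracket_swap_apply (V := Y) (W := X), g.symm x _ (Z x)]
  simp only [map_neg]
  ring

/-- The curvature `R(X, Y)Z = ∇_X ∇_Y Z - ∇_Y ∇_X Z - ∇_[X, Y] Z` of the Levi-Civita connection,
evaluated at `x`. -/
def curvature (X Y Z : Π x : M, TangentSpace I x) (x : M) : TangentSpace I x :=
  leviCivita g (fun y ↦ leviCivita g Z y (Y y)) x (X x)
    - leviCivita g (fun y ↦ leviCivita g Z y (X y)) x (Y x)
    - leviCivita g Z x (mlieBracket I X Y x)

end LeviCivita

section Paracontact

variable {E : Type*} [NormedAddCommGroup E] [NormedSpace ℝ E] [FiniteDimensional ℝ E]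
  {H : Type*} [TopologicalSpace H] {I : ModelWithCorners ℝ E H}
  {M : Type*} [TopologicalSpace M] [ChartedSpace H M] [IsManifold I ∞ M] {n : ℕ}

set_option linter.unusedSectionVars false

/-- The exterior derivative of a one-form `η`, with the normalization
`2 dη(X, Y) = X η(Y) - Y η(X) - η([X, Y])` which is customary in (para)contact metric geometry,
evaluated at `x`. -/
def extDerivOneForm (η : Π x : M, TangentSpace I x →L[ℝ] ℝ) (X Y : Π x : M, TangentSpace I x)
    (x : M) : ℝ :=
  1 / 2 * (d% (fun y ↦ η y (Y y)) x (X x) - d% (fun y ↦ η y (X y)) x (Y x)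
    - η x (mlieBracket I X Y x))

/-- The Nijenhuis tensor
`[φ, φ](X, Y) = φ² [X, Y] + [φ X, φ Y] - φ [φ X, Y] - φ [X, φ Y]` of a field of
endomorphisms `φ`, evaluated at `x`. -/
def nijenhuis (φ : Π x : M, TangentSpace I x →L[ℝ] TangentSpace I x)
    (X Y : Π x : M, TangentSpace I x) (x : M) : TangentSpace I x :=
  φ x (φ x (mlieBracket I X Y x))
    + mlieBracket I (fun y ↦ φ y (X y)) (fun y ↦ φ y (Y y)) x
    - φ x (mlieBracket I (fun y ↦ φ y (X y)) Y x)
    - φ x (mlieBracket I X (fun y ↦ φ y (Y y)) x)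

/-- The Lie derivative `(L_ξ φ) X = [ξ, φ X] - φ [ξ, X]` of a field of endomorphisms `φ`,
evaluated at `x`. -/
def lieDerivEndo (ξ : Π x : M, TangentSpace I x)
    (φ : Π x : M, TangentSpace I x →L[ℝ] TangentSpace I x)
    (X : Π x : M, TangentSpace I x) (x : M) : TangentSpace I x :=
  mlieBracket I ξ (fun y ↦ φ y (X y)) x - φ x (mlieBracket I ξ X x)

variable (I M n) in
/-- An almost paracontact structure `(φ, ξ, η)`, where the eigendistributions of `φ` for `1` and
`-1` both have dimension `n`. -/
structure AlmostParacontactStructure where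
  /-- The structure endomorphism `φ`. -/
  phi (x : M) : TangentSpace I x →L[ℝ] TangentSpace I x
  /-- The characteristic vector field `ξ`. -/
  xi (x : M) : TangentSpace I x
  /-- The one-form `η`. -/
  eta (x : M) : TangentSpace I x →L[ℝ] ℝ
  contMDiff_phi : ContMDiff I (I.prod 𝓘(ℝ, E →L[ℝ] E)) ∞
    (fun x ↦ TotalSpace.mk' (E →L[ℝ] E) x (phi x))
  contMDiff_xi : ContMDiff I (I.prod 𝓘(ℝ, E)) ∞ (fun x ↦ TotalSpace.mk' E x (xi x))
  contMDiff_eta : ContMDiff I (I.prod 𝓘(ℝ, E →L[ℝ] ℝ)) ∞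
    (fun x ↦ TotalSpace.mk' (E →L[ℝ] ℝ) x (eta x))
  eta_xi (x : M) : eta x (xi x) = 1
  phi_phi (x : M) (v : TangentSpace I x) : phi x (phi x v) = v - eta x v • xi x
  finrank_eigenspace_one (x : M) :
    finrank ℝ (Module.End.eigenspace (phi x).toLinearMap (1 : ℝ)) = n
  finrank_eigenspace_neg_one (x : M) :
    finrank ℝ (Module.End.eigenspace (phi x).toLinearMap (-1 : ℝ)) = n

namespace AlmostParacontactStructure

variable (S : AlmostParacontactStructure I M n)

lemma mdifferentiableAt_phi {X : Π x : M, TangentSpace I x} {x : M} (hX : MDiffAt (T% X) x) :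
    MDiffAt (T% (fun y ↦ S.phi y (X y))) x :=
  MDifferentiableAt.clm_bundle_apply (F₁ := E) (F₂ := E)
    (S.contMDiff_phi.mdifferentiableAt (by simp)) hX

lemma tensorialAt_lieDerivEndo (x : M) :
    TensorialAt I E (fun X ↦ (1 / 2 : ℝ) • lieDerivEndo S.xi S.phi X x) x where
  smul {f X} hf hX := by
    have h : (fun y ↦ S.phi y ((f • X) y)) = f • fun y ↦ S.phi y (X y) := by
      ext y; simp
    simp only [lieDerivEndo, h, mlieBracket_smul_right hf hX,
      mlieBracket_smul_right hf (S.mdifferentiableAt_phi hX), map_add, map_smul]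
    module
  add {X X'} hX hX' := by
    have h : (fun y ↦ S.phi y ((X + X') y)) =
        (fun y ↦ S.phi y (X y)) + fun y ↦ S.phi y (X' y) := by
      ext y; simp
    simp only [lieDerivEndo, h, mlieBracket_add_right hX hX',
      mlieBracket_add_right (S.mdifferentiableAt_phi hX) (S.mdifferentiableAt_phi hX'), map_add]
    module

/-- The tensor field `h = (1/2) L_ξ φ`. -/
def h (x : M) : TangentSpace I x →L[ℝ] TangentSpace I x :=
  TensorialAt.mkHom (fun X ↦ (1 / 2 : ℝ) • lieDerivEndo S.xi S.phi X x) x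
    (S.tensorialAt_lieDerivEndo x)

lemma h_apply {X : Π x : M, TangentSpace I x} {x : M} (hX : MDiffAt (T% X) x) :
    S.h x (X x) = (1 / 2 : ℝ) • lieDerivEndo S.xi S.phi X x :=
  TensorialAt.mkHom_apply _ hX

/-- An almost paracontact structure is normal if the tensor `[φ, φ] - 2 dη ⊗ ξ` vanishes. -/
def IsNormal : Prop :=
  ∀ (x : M) (X Y : Π x : M, TangentSpace I x),
    CMDiffAt ∞ (T% X) x → CMDiffAt ∞ (T% Y) x →
      nijenhuis S.phi X Y x - (2 * extDerivOneForm S.eta X Y x) • S.xi x = 0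

end AlmostParacontactStructure

variable (I M n) in
/-- A paracontact metric structure `(φ, ξ, η, g)`: an almost paracontact structure with a
compatible semi-Riemannian metric `g`, such that `dη` is the fundamental two-form
`Φ(X, Y) = g(X, φ Y)`. -/
structure ParacontactMetricStructure extends AlmostParacontactStructure I M n where
  /-- The semi-Riemannian metric. -/
  metric : SemiRiemannianMetric I M
  metric_phi_phi (x : M) (v w : TangentSpace I x) :
    metric.inner x (phi x v) (phi x w) = -metric.inner x v w + eta x v * eta x w
  extDeriv_eta (x : M) (X Y : Π x : M, TangentSpace I x)
    (hX : CMDiffAt ∞ (T% X) x) (hY : CMDiffAt ∞ (T% Y) x) :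
    extDerivOneForm eta X Y x = metric.inner x (X x) (phi x (Y x))

namespace ParacontactMetricStructure

variable (S : ParacontactMetricStructure I M n)

/-- A paraSasakian structure is a normal paracontact metric structure. -/
def IsParaSasakian : Prop := S.IsNormal

/-- The `(κ, μ)`-nullity condition
`R(X, Y)ξ = κ (η(Y) X - η(X) Y) + μ (η(Y) h X - η(X) h Y)`, with real constants `κ` and `μ`. -/
def IsKappaMuSpace (κ μ : ℝ) : Prop :=
  ∀ (x : M) (X Y : Π x : M, TangentSpace I x),
    CMDiffAt ∞ (T% X) x → CMDiffAt ∞ (T% Y) x →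
      curvature S.metric X Y S.xi x =
        κ • (S.eta x (Y x) • X x - S.eta x (X x) • Y x)
          + μ • (S.eta x (Y x) • S.h x (X x) - S.eta x (X x) • S.h x (Y x))

/-- The rank of `h` at the point `p`. -/
def rankH (p : M) : ℕ := finrank ℝ (LinearMap.range (S.h p).toLinearMap)

/-- A basis `{ξ, X₁, …, Xₙ, Y₁, …, Yₙ}` of the tangent space at `p`, where
`X i = b (.inr (.inl i))` and `Y i = b (.inr (.inr i))`, such that the only non-vanishing
components of the metric are `g(ξ, ξ) = 1` and `g(X i, Y i) = ±1`, and such that each plane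
spanned by `X i` and `Y i` is mapped to itself by `h`, with matrix `!![0, 0; 1, 0]` (that is,
`h (X i) = Y i` and `h (Y i) = 0`) or `0`, where the first type occurs exactly `rank (h_p)`
times. -/
structure IsAdaptedBasis (p : M) (b : Basis (Unit ⊕ (Fin n ⊕ Fin n)) ℝ (TangentSpace I p)) :
    Prop where
  xi_eq : b (.inl ()) = S.xi p
  metric_xi_xi : S.metric.inner p (S.xi p) (S.xi p) = 1
  metric_xi_X (i : Fin n) : S.metric.inner p (S.xi p) (b (.inr (.inl i))) = 0
  metric_xi_Y (i : Fin n) : S.metric.inner p (S.xi p) (b (.inr (.inr i))) = 0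
  metric_X_X (i j : Fin n) : S.metric.inner p (b (.inr (.inl i))) (b (.inr (.inl j))) = 0
  metric_Y_Y (i j : Fin n) : S.metric.inner p (b (.inr (.inr i))) (b (.inr (.inr j))) = 0
  metric_X_Y_of_ne (i j : Fin n) (hij : i ≠ j) :
    S.metric.inner p (b (.inr (.inl i))) (b (.inr (.inr j))) = 0
  metric_X_Y (i : Fin n) : S.metric.inner p (b (.inr (.inl i))) (b (.inr (.inr i))) = 1 ∨
    S.metric.inner p (b (.inr (.inl i))) (b (.inr (.inr i))) = -1
  h_blocks (i : Fin n) :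
    (S.h p (b (.inr (.inl i))) = b (.inr (.inr i)) ∧ S.h p (b (.inr (.inr i))) = 0) ∨
      (S.h p (b (.inr (.inl i))) = 0 ∧ S.h p (b (.inr (.inr i))) = 0)
  card_blocks :
    {i : Fin n | S.h p (b (.inr (.inl i))) = b (.inr (.inr i))}.ncard = S.rankH p

end ParacontactMetricStructure

end Paracontact

end ParacontactGeometry

end

noncomputable section

open Filter Topology

namespace ParacontactGeometry

set_option linter.unusedSectionVars false

variable {E : Type*} [NormedAddCommGroup E] [NormedSpace ℝ E] [FiniteDimensional ℝ E]
  {H : Type*} [TopologicalSpace H] {I : ModelWithCorners ℝ E H}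
  {M : Type*} [TopologicalSpace M] [ChartedSpace H M] [IsManifold I ∞ M] {n : ℕ}

/-! ### Algebra of an almost paracontact structure -/

namespace AlmostParacontactStructure

variable (S : AlmostParacontactStructure I M n)

/-! Write A = ∇ξ. The condition dη = Φ says that A + φ is self-adjoint. It also gives L_ξη = 0,
hence L_ξΦ = 0 (`mvfderiv_inner_phi`), which expresses ∇_ξφ as minus the anticommutator of A + φ
with φ. As φ² is parallel along ξ, this anticommutator vanishes (`phi_leviCivita_xi_add_phi`). Hence
∇_ξφ = 0 and h = φ(A + φ), that is A = φh - φ, with h self-adjoint and anticommuting with φ.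

Now R(ξ, X)ξ = φ(∇_ξh)X + φ²X - h²X. For κ = -1 the nullity condition cancels φ²X and leaves φ(∇_ξh)
= h² - μh. The left side and h anticommute with φ, whereas h² commutes with it, so h² = 0
(`IsKappaMuSpace.h_h`).

If h = 0, then A = -φ and the curvature condition prescribes (∇_Xφ)Y - (∇_Yφ)X. As ∇_Xφ is skew,
this determines ∇φ, and normality follows.

If h ≠ 0, the rest is linear algebra at a point. The ±1 eigenspaces of φ are null, put in duality by
g and exchanged by h. Since h² = 0, the two symmetric forms that h induces on them can be
diagonalized in dual bases (`exists_dual_bases_diagonal`). Rescaling each dual pair gives the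
adapted basis. -/

lemma phi_xi (x : M) : S.phi x (S.xi x) = 0 := by
  have h1 : S.phi x (S.phi x (S.xi x)) = 0 := by simp [S.phi_phi, S.eta_xi]
  obtain ⟨c, hc⟩ : ∃ c : ℝ, S.phi x (S.xi x) = c • S.xi x := by
    refine ⟨S.eta x (S.phi x (S.xi x)), ?_⟩
    have h2 := S.phi_phi x (S.phi x (S.xi x))
    rwa [h1, map_zero, eq_comm, sub_eq_zero] at h2
  have h3 : S.xi x ≠ 0 := fun h ↦ by simpa [h] using S.eta_xi x
  rw [hc, map_smul, hc, smul_smul, smul_eq_zero, or_iff_left h3, mul_self_eq_zero] at h1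
  rw [hc, h1, zero_smul]

lemma eta_phi (x : M) (v : TangentSpace I x) : S.eta x (S.phi x v) = 0 := by
  have h1 := S.phi_phi x (S.phi x v)
  have h2 : S.phi x (S.phi x (S.phi x v)) = S.phi x v := by
    rw [S.phi_phi x v, map_sub, map_smul, S.phi_xi, smul_zero, sub_zero]
  rw [h2, eq_comm, sub_eq_self] at h1
  simpa [S.eta_xi] using congrArg (S.eta x) h1

lemma phi_phi_phi (x : M) (v : TangentSpace I x) : S.phi x (S.phi x (S.phi x v)) = S.phi x v := by
  rw [S.phi_phi, S.eta_phi]; simp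

end AlmostParacontactStructure

/-! ### The metric, dη and the covariant derivative of ξ -/

namespace ParacontactMetricStructure

variable (S : ParacontactMetricStructure I M n)

lemma inner_xi_right (x : M) (v : TangentSpace I x) : S.metric.inner x v (S.xi x) = S.eta x v := by
  have := S.metric_phi_phi x v (S.xi x)
  rw [S.phi_xi, S.eta_xi, map_zero] at this
  linarith

lemma inner_xi_left (x : M) (v : TangentSpace I x) : S.metric.inner x (S.xi x) v = S.eta x v := by
  rw [S.metric.symm, S.inner_xi_right]

lemma inner_phi_left (x : M) (v w : TangentSpace I x) :
    S.metric.inner x (S.phi x v) w = -S.metric.inner x v (S.phi x w) := by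
  have := S.metric_phi_phi x v (S.phi x w)
  rw [S.phi_phi, map_sub, map_smul, S.inner_xi_right, S.eta_phi, S.eta_phi] at this
  simpa using this

lemma mdifferentiableAt_xi (x : M) : MDiffAt (T% S.xi) x :=
  S.contMDiff_xi.mdifferentiableAt (by simp)

lemma eta_eq_inner (X : Π x : M, TangentSpace I x) :
    (fun y ↦ S.eta y (X y)) = fun y ↦ S.metric.inner y (S.xi y) (X y) :=
  funext fun y ↦ (S.inner_xi_left y (X y)).symm

lemma mdifferentiableAt_eta {X : Π x : M, TangentSpace I x} {x : M} (hX : MDiffAt (T% X) x) :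
    MDiffAt (fun y ↦ S.eta y (X y)) x := by
  rw [S.eta_eq_inner]
  exact S.metric.mdifferentiableAt (S.mdifferentiableAt_xi x) hX

lemma mvfderiv_eta {X Y : Π x : M, TangentSpace I x} {x : M} (hX : MDiffAt (T% X) x)
    (hY : MDiffAt (T% Y) x) :
    d% (fun y ↦ S.eta y (Y y)) x (X x) =
      S.metric.inner x (leviCivita S.metric S.xi x (X x)) (Y x)
        + S.eta x (leviCivita S.metric Y x (X x)) := by
  rw [S.eta_eq_inner, leviCivita_metric S.metric hX (S.mdifferentiableAt_xi x) hY, S.inner_xi_left]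

lemma extDerivOneForm_eta {X Y : Π x : M, TangentSpace I x} {x : M} (hX : MDiffAt (T% X) x)
    (hY : MDiffAt (T% Y) x) :
    2 * extDerivOneForm S.eta X Y x =
      S.metric.inner x (leviCivita S.metric S.xi x (X x)) (Y x)
        - S.metric.inner x (X x) (leviCivita S.metric S.xi x (Y x)) := by
  rw [extDerivOneForm, S.mvfderiv_eta hX hY, S.mvfderiv_eta hY hX,
    ← leviCivita_torsion S.metric hX hY, map_sub, S.metric.symm x (X x)]
  ring

/-- Since ∇ is torsion-free, 2dη is the skew part of ∇ξ. As φ is skew, this amounts to the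
self-adjointness of ∇ξ + φ. -/
lemma inner_leviCivita_xi_sub (x : M) (v w : TangentSpace I x) :
    S.metric.inner x (leviCivita S.metric S.xi x v) w
      - S.metric.inner x v (leviCivita S.metric S.xi x w) = 2 * S.metric.inner x v (S.phi x w) := by
  have h1 := S.extDerivOneForm_eta (FiberBundle.mdifferentiableAt_extend I E v)
    (FiberBundle.mdifferentiableAt_extend I E w)
  rw [S.extDeriv_eta x _ _ (FiberBundle.contMDiffAt_extend I E v)
    (FiberBundle.contMDiffAt_extend I E w)] at h1
  simpa using h1.symm

/-- The structure only provides dη = Φ on smooth fields. Both sides depend on the values at `x`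
alone, so differentiability suffices. -/
lemma extDerivOneForm_eta_eq {X Y : Π x : M, TangentSpace I x} {x : M} (hX : MDiffAt (T% X) x)
    (hY : MDiffAt (T% Y) x) :
    extDerivOneForm S.eta X Y x = S.metric.inner x (X x) (S.phi x (Y x)) := by
  have := S.extDerivOneForm_eta hX hY
  rw [S.inner_leviCivita_xi_sub] at this
  linarith

lemma eta_leviCivita_xi (x : M) (v : TangentSpace I x) :
    S.eta x (leviCivita S.metric S.xi x v) = 0 := by
  have h1 := S.mvfderiv_eta (FiberBundle.mdifferentiableAt_extend I E v) (S.mdifferentiableAt_xi x)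
  have h2 : (fun y ↦ S.eta y (S.xi y)) = fun _ ↦ (1 : ℝ) := funext S.eta_xi
  rw [h2, mvfderiv_const, S.inner_xi_right] at h1
  simp at h1
  linarith

lemma leviCivita_xi_xi (x : M) : leviCivita S.metric S.xi x (S.xi x) = 0 := by
  refine S.metric.nondegenerate x _ fun w ↦ ?_
  have := S.inner_leviCivita_xi_sub x (S.xi x) w
  rw [S.inner_xi_left, S.inner_xi_left, S.eta_leviCivita_xi, S.eta_phi] at this
  linarith

/-- This is L_ξη = 0; it holds because ξ is a geodesic field and η ∘ ∇ξ = 0. -/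
lemma mvfderiv_eta_xi {Y : Π x : M, TangentSpace I x} {x : M} (hY : MDiffAt (T% Y) x) :
    d% (fun y ↦ S.eta y (Y y)) x (S.xi x) = S.eta x (mlieBracket I S.xi Y x) := by
  rw [S.mvfderiv_eta (S.mdifferentiableAt_xi x) hY, S.leviCivita_xi_xi,
    ← leviCivita_torsion S.metric (S.mdifferentiableAt_xi x) hY, map_sub, S.eta_leviCivita_xi]
  simp

end ParacontactMetricStructure

/-! ### Calculus of brackets and directional derivatives -/

lemma eventually_mdifferentiableAt_of_contMDiffAt {X : Π x : M, TangentSpace I x} {x : M}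
    (hX : CMDiffAt ∞ (T% X) x) : ∀ᶠ y in 𝓝 x, MDiffAt (T% X) y :=
  ((contMDiffAt_iff_contMDiffAt_nhds (n := 1) (by simp)).1 (hX.of_le (by simp))).mono
    fun _ hy ↦ hy.mdifferentiableAt one_ne_zero

lemma contMDiffAt_mlieBracket {X Y : Π x : M, TangentSpace I x} {x : M}
    (hX : CMDiffAt ∞ (T% X) x) (hY : CMDiffAt ∞ (T% Y) x) :
    CMDiffAt ∞ (T% (mlieBracket I X Y)) x := by
  have : IsManifold I (minSmoothness ℝ 2) M := by
    rw [minSmoothness_of_isRCLikeNormedField]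
    exact IsManifold.of_le (n := ∞) ENat.LEInfty.out
  have : IsManifold I ((⊤ : ℕ∞) + 1) M := by simpa
  exact ContMDiffAt.mlieBracket_vectorField (m := ⊤) (n := ⊤) hX hY
    (by rw [minSmoothness_of_isRCLikeNormedField]; exact le_rfl)

lemma jacobi_mlieBracket {X Y Z : Π x : M, TangentSpace I x} {x : M}
    (hX : CMDiffAt ∞ (T% X) x) (hY : CMDiffAt ∞ (T% Y) x) (hZ : CMDiffAt ∞ (T% Z) x) :
    mlieBracket I X (mlieBracket I Y Z) x =
      mlieBracket I (mlieBracket I X Y) Z x + mlieBracket I Y (mlieBracket I X Z) x := by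
  have : IsManifold I (minSmoothness ℝ 3) M := by
    rw [minSmoothness_of_isRCLikeNormedField]
    exact IsManifold.of_le (n := ∞) ENat.LEInfty.out
  have h : minSmoothness ℝ 2 ≤ ∞ := by
    rw [minSmoothness_of_isRCLikeNormedField]; exact ENat.LEInfty.out
  exact leibniz_identity_mlieBracket_apply (hX.of_le h) (hY.of_le h) (hZ.of_le h)

lemma mvfderiv_congr {f g : M → ℝ} {x : M} (h : f =ᶠ[𝓝 x] g) : d% f x = d% g x := by
  ext v
  simp only [mvfderiv, h.mfderiv_eq]
  rfl

namespace AlmostParacontactStructure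

variable (S : AlmostParacontactStructure I M n)

lemma contMDiffAt_phi {X : Π x : M, TangentSpace I x} {x : M} (hX : CMDiffAt ∞ (T% X) x) :
    CMDiffAt ∞ (T% (fun y ↦ S.phi y (X y))) x :=
  ContMDiffAt.clm_bundle_apply (F₁ := E) (F₂ := E) S.contMDiff_phi.contMDiffAt hX

lemma contMDiffAt_eta {X : Π x : M, TangentSpace I x} {x : M} (hX : CMDiffAt ∞ (T% X) x) :
    CMDiffAt ∞ (fun y ↦ S.eta y (X y)) x := by
  have : ContMDiffAt I (I.prod 𝓘(ℝ)) ∞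
      (fun y ↦ TotalSpace.mk' ℝ (E := Bundle.Trivial M ℝ) y (S.eta y (X y))) x :=
    ContMDiffAt.clm_bundle_apply (F₁ := E) (F₂ := ℝ) S.contMDiff_eta.contMDiffAt hX
  exact (contMDiffAt_totalSpace.1 this).2

/-- Apply η to [X, fξ] = (Xf)ξ + f[X, ξ]. Smoothness of Xf is thereby reduced to smoothness of
brackets. -/
lemma mvfderiv_eventuallyEq {f : M → ℝ} {X : Π x : M, TangentSpace I x} {x : M}
    (hf : CMDiffAt ∞ f x) :
    (fun y ↦ d% f y (X y)) =ᶠ[𝓝 x] fun y ↦ S.eta y (mlieBracket I X (f • S.xi) y)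
      - f y * S.eta y (mlieBracket I X S.xi y) := by
  have hf' : ∀ᶠ y in 𝓝 x, MDiffAt f y :=
    ((contMDiffAt_iff_contMDiffAt_nhds (n := 1) (by simp)).1 (hf.of_le (by simp))).mono
      fun _ hy ↦ hy.mdifferentiableAt one_ne_zero
  filter_upwards [hf'] with y hy
  rw [mlieBracket_smul_right hy (S.contMDiff_xi.mdifferentiableAt (by simp))]
  simp [S.eta_xi]

lemma contMDiffAt_mvfderiv (S : AlmostParacontactStructure I M n) {f : M → ℝ} {X : Π x : M, TangentSpace I x} {x : M}
    (hf : CMDiffAt ∞ f x) (hX : CMDiffAt ∞ (T% X) x) :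
    CMDiffAt ∞ (fun y ↦ d% f y (X y)) x := by
  have hξ : CMDiffAt ∞ (T% S.xi) x := S.contMDiff_xi.contMDiffAt
  refine ContMDiffAt.congr_of_eventuallyEq ?_ (S.mvfderiv_eventuallyEq hf)
  exact (S.contMDiffAt_eta (contMDiffAt_mlieBracket hX (hf.smul_section hξ))).sub
    (hf.mul (S.contMDiffAt_eta (contMDiffAt_mlieBracket hX hξ)))

/-- The bracket of vector fields is the commutator of the associated derivations. -/
lemma mvfderiv_mvfderiv_sub (S : AlmostParacontactStructure I M n) {f : M → ℝ} {X Y : Π x : M, TangentSpace I x} {x : M}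
    (hf : CMDiffAt ∞ f x) (hX : CMDiffAt ∞ (T% X) x) (hY : CMDiffAt ∞ (T% Y) x) :
    d% (fun y ↦ d% f y (Y y)) x (X x) - d% (fun y ↦ d% f y (X y)) x (Y x) =
      d% f x (mlieBracket I X Y x) := by
  have hξ : CMDiffAt ∞ (T% S.xi) x := S.contMDiff_xi.contMDiffAt
  have hξd (y : M) : MDiffAt (T% S.xi) y := S.contMDiff_xi.mdifferentiableAt (by simp)
  have hf' : ∀ᶠ y in 𝓝 x, MDiffAt f y :=
    ((contMDiffAt_iff_contMDiffAt_nhds (n := 1) (by simp)).1 (hf.of_le (by simp))).mono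
      fun _ hy ↦ hy.mdifferentiableAt one_ne_zero
  have key {A B : Π x : M, TangentSpace I x} (hA : CMDiffAt ∞ (T% A) x)
      (hB : CMDiffAt ∞ (T% B) x) : mlieBracket I A (mlieBracket I B (f • S.xi)) x =
        d% (fun y ↦ d% f y (B y)) x (A x) • S.xi x + d% f x (B x) • mlieBracket I A S.xi x
        + (d% f x (A x) • mlieBracket I B S.xi x
          + f x • mlieBracket I A (mlieBracket I B S.xi) x) := by
    have h1 : mlieBracket I B (f • S.xi) =ᶠ[𝓝 x]
        (fun y ↦ d% f y (B y)) • S.xi + f • mlieBracket I B S.xi := by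
      filter_upwards [hf'] with y hy
      rw [mlieBracket_smul_right hy (hξd y)]
      rfl
    have hd := S.contMDiffAt_mvfderiv hf hB
    have hb := contMDiffAt_mlieBracket hB hξ
    rw [(EventuallyEq.refl _ A).mlieBracket_vectorField_eq h1,
      mlieBracket_add_right ((hd.smul_section hξ).mdifferentiableAt (by simp))
        ((hf.smul_section hb).mdifferentiableAt (by simp)),
      mlieBracket_smul_right (hd.mdifferentiableAt (by simp)) (hξd x),
      mlieBracket_smul_right hf'.self_of_nhds (hb.mdifferentiableAt (by simp))]
  -- The Jacobi identity for X, Y, fξ contains the claim as the coefficient of ξ. The terms (Xf)[Y,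
  -- ξ] + (Yf)[X, ξ] are symmetric in X and Y and cancel; those with undifferentiated f cancel by
  -- the Jacobi identity for X, Y, ξ.
  have hJ := jacobi_mlieBracket hX hY (hf.smul_section hξ)
  rw [key hX hY, key hY hX, mlieBracket_smul_right hf'.self_of_nhds (hξd x),
    jacobi_mlieBracket hX hY hξ] at hJ
  have := congrArg (S.eta x) hJ
  simp only [map_add, map_smul, S.eta_xi, smul_eq_mul] at this
  linarith

end AlmostParacontactStructure

/-! ### Parallelism of φ along ξ, and the properties of h -/

namespace ParacontactMetricStructure

variable (S : ParacontactMetricStructure I M n)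

/-- The fundamental two-form is invariant under the flow of the characteristic vector field. -/
lemma mvfderiv_inner_phi {X Y : Π x : M, TangentSpace I x} {x : M}
    (hX : CMDiffAt ∞ (T% X) x) (hY : CMDiffAt ∞ (T% Y) x) :
    d% (fun y ↦ S.metric.inner y (X y) (S.phi y (Y y))) x (S.xi x) =
      S.metric.inner x (mlieBracket I S.xi X x) (S.phi x (Y x))
        + S.metric.inner x (X x) (S.phi x (mlieBracket I S.xi Y x)) := by
  have hξ : CMDiffAt ∞ (T% S.xi) x := S.contMDiff_xi.contMDiffAt
  have hξX := contMDiffAt_mlieBracket hξ hX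
  have hξY := contMDiffAt_mlieBracket hξ hY
  have hXY := contMDiffAt_mlieBracket hX hY
  have hηX := S.contMDiffAt_eta hX
  have hηY := S.contMDiffAt_eta hY
  have hdX := S.contMDiffAt_mvfderiv hηX hY
  have hdY := S.contMDiffAt_mvfderiv hηY hX
  have e1 : (fun y ↦ S.metric.inner y (X y) (S.phi y (Y y))) =ᶠ[𝓝 x]
      fun y ↦ extDerivOneForm S.eta X Y y := by
    filter_upwards [eventually_mdifferentiableAt_of_contMDiffAt hX,
      eventually_mdifferentiableAt_of_contMDiffAt hY] with y h1 h2
    rw [S.extDerivOneForm_eta_eq h1 h2]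
  -- L_ξη = 0 is needed on a neighbourhood, because it is differentiated once more. With the
  -- commutators `c1`, `c2` and the Jacobi identity it yields L_ξ(dη) = 0.
  have hl {Z : Π x : M, TangentSpace I x} (hZ : CMDiffAt ∞ (T% Z) x) :
      (fun y ↦ d% (fun z ↦ S.eta z (Z z)) y (S.xi y)) =ᶠ[𝓝 x]
        fun y ↦ S.eta y (mlieBracket I S.xi Z y) := by
    filter_upwards [eventually_mdifferentiableAt_of_contMDiffAt hZ] with y h1
    rw [S.mvfderiv_eta_xi h1]
  have c1 := S.mvfderiv_mvfderiv_sub hηX hξ hY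
  have c2 := S.mvfderiv_mvfderiv_sub hηY hξ hX
  rw [mvfderiv_congr (hl hX)] at c1
  rw [mvfderiv_congr (hl hY)] at c2
  rw [mvfderiv_congr e1, ← S.extDerivOneForm_eta_eq (hξX.mdifferentiableAt (by simp))
      (hY.mdifferentiableAt (by simp)), ← S.extDerivOneForm_eta_eq
      (hX.mdifferentiableAt (by simp)) (hξY.mdifferentiableAt (by simp))]
  have hJ := congrArg (S.eta x) (jacobi_mlieBracket hξ hX hY)
  have h3 : d% (extDerivOneForm S.eta X Y) x (S.xi x) = 1 / 2 *
      (d% (fun y ↦ d% (fun z ↦ S.eta z (Y z)) y (X y)) x (S.xi x)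
        - d% (fun y ↦ d% (fun z ↦ S.eta z (X z)) y (Y y)) x (S.xi x)
        - d% (fun y ↦ S.eta y (mlieBracket I X Y y)) x (S.xi x)) := by
    have h4 := mvfderiv_fun_sub (hdY.mdifferentiableAt (by simp)) (hdX.mdifferentiableAt (by simp))
    have h5 := mvfderiv_fun_sub ((hdY.sub hdX).mdifferentiableAt (by simp))
      ((S.contMDiffAt_eta hXY).mdifferentiableAt (by simp))
    have h6 := mvfderiv_fun_mul (f := fun _ ↦ (1 / 2 : ℝ)) mdifferentiableAt_const
      (((hdY.sub hdX).sub (S.contMDiffAt_eta hXY)).mdifferentiableAt (by simp))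
    have h7 : d% (extDerivOneForm S.eta X Y) x = _ := h6
    rw [h7, h5, h4, mvfderiv_const]
    simp
  rw [h3, S.mvfderiv_eta_xi (hXY.mdifferentiableAt (by simp)), hJ]
  simp only [extDerivOneForm, map_add]
  linarith

/-- The covariant derivative of `φ` along `ξ`, in terms of the one of `ξ`. -/
lemma leviCivita_phi_xi {Y : Π x : M, TangentSpace I x} {x : M} (hY : CMDiffAt ∞ (T% Y) x) :
    leviCivita S.metric (fun y ↦ S.phi y (Y y)) x (S.xi x)
      - S.phi x (leviCivita S.metric Y x (S.xi x)) =
      -leviCivita S.metric S.xi x (S.phi x (Y x)) - S.phi x (leviCivita S.metric S.xi x (Y x))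
        - (2 : ℝ) • S.phi x (S.phi x (Y x)) := by
  rw [← sub_eq_zero]
  refine S.metric.nondegenerate x _ fun w ↦ ?_
  have hw := FiberBundle.contMDiffAt_extend I E (k := ∞) w
  set X := FiberBundle.extend E w with hXdef
  have hwX : w = X x := by simp [hXdef]
  rw [hwX]
  have hξ := S.mdifferentiableAt_xi x
  have hX' : MDiffAt (T% X) x := hw.mdifferentiableAt (by simp)
  have hY' : MDiffAt (T% Y) x := hY.mdifferentiableAt (by simp)
  have h1 := S.mvfderiv_inner_phi hw hY
  rw [leviCivita_metric S.metric hξ hX' (S.mdifferentiableAt_phi hY'),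
    ← leviCivita_torsion S.metric hξ hX', ← leviCivita_torsion S.metric hξ hY'] at h1
  have h2 := S.inner_leviCivita_xi_sub x (X x) (S.phi x (Y x))
  simp only [map_sub, map_neg, map_smul, _root_.sub_apply, _root_.neg_apply, _root_.smul_apply,
    smul_eq_mul, S.metric.symm x _ (X x)] at h1 h2 ⊢
  rw [S.metric.symm x (leviCivita S.metric S.xi x (X x))] at h1 h2
  linarith

/-- φ² = I - η ⊗ ξ is parallel along ξ because ∇_ξξ = 0. -/
lemma leviCivita_phi_phi {Y : Π x : M, TangentSpace I x} {x : M} (hY : MDiffAt (T% Y) x) :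
    leviCivita S.metric (fun y ↦ S.phi y (S.phi y (Y y))) x (S.xi x) =
      S.phi x (S.phi x (leviCivita S.metric Y x (S.xi x))) := by
  have h1 : (fun y ↦ S.phi y (S.phi y (Y y))) = Y + (fun y ↦ -S.eta y (Y y)) • S.xi := by
    ext y
    simp [S.phi_phi, sub_eq_add_neg]
  have hη := S.mdifferentiableAt_eta hY
  have hη' : MDiffAt (fun y ↦ -S.eta y (Y y)) x := hη.neg
  rw [h1, (leviCivita S.metric).isCovariantDerivativeOnUniv.add hY
      (hη'.smul_section (S.mdifferentiableAt_xi x)),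
    (leviCivita S.metric).isCovariantDerivativeOnUniv.leibniz (S.mdifferentiableAt_xi x) hη']
  have h2 := S.mvfderiv_eta (S.mdifferentiableAt_xi x) hY
  rw [S.leviCivita_xi_xi] at h2
  have h3 : d% (fun y ↦ -S.eta y (Y y)) x = -d% (fun y ↦ S.eta y (Y y)) x := mvfderiv_fun_neg
  simp [S.phi_phi, h3, h2, S.leviCivita_xi_xi, sub_eq_add_neg]

/-- The symmetric part `∇ξ + φ` of the covariant derivative of `ξ` anticommutes with `φ`. -/
lemma phi_leviCivita_xi_add_phi (x : M) (v : TangentSpace I x) :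
    S.phi x (leviCivita S.metric S.xi x v + S.phi x v) =
      -(leviCivita S.metric S.xi x (S.phi x v) + S.phi x (S.phi x v)) := by
  -- With B = ∇ξ + φ this says φBφ = -B; applying φ then gives the claim. It comes from (∇_ξφ)φ +
  -- φ(∇_ξφ) = ∇_ξ(φ²) = 0, with ∇_ξφ = -(Bφ + φB) inserted.
  have key (v : TangentSpace I x) : S.phi x (leviCivita S.metric S.xi x (S.phi x v)) =
      -leviCivita S.metric S.xi x v - (2 : ℝ) • S.phi x v := by
    have hY := FiberBundle.contMDiffAt_extend I E (k := ∞) v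
    set Y := FiberBundle.extend E v with hYdef
    have hv : v = Y x := by simp [hYdef]
    have h1 := S.leviCivita_phi_xi hY
    have h2 := S.leviCivita_phi_xi (S.contMDiffAt_phi hY)
    rw [S.leviCivita_phi_phi (hY.mdifferentiableAt (by simp)), S.phi_phi_phi] at h2
    rw [hv]
    set A := leviCivita S.metric S.xi x
    have h3 : A (S.phi x (S.phi x (Y x))) = A (Y x) := by
      rw [S.phi_phi, map_sub, map_smul, S.leviCivita_xi_xi, smul_zero, sub_zero]
    have h4 : S.phi x (S.phi x (A (Y x))) = A (Y x) := by
      rw [S.phi_phi, S.eta_leviCivita_xi, zero_smul, sub_zero]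
    have h5 := congrArg (S.phi x) h1
    simp only [map_sub, map_neg, map_smul, S.phi_phi_phi, h4] at h5
    rw [h3] at h2
    have h6 := congrArg₂ (· + ·) h2 h5
    simp only at h6
    have h7 : (2 : ℝ) • S.phi x (A (S.phi x (Y x))) =
      (2 : ℝ) • (-A (Y x) - (2 : ℝ) • S.phi x (Y x)) := by
      rw [← sub_eq_zero] at h6 ⊢
      rw [← h6]
      module
    exact smul_right_injective _ (two_ne_zero (α := ℝ)) h7
  have h1 := congrArg (S.phi x) (key v)
  rw [S.phi_phi x (leviCivita S.metric S.xi x (S.phi x v)), S.eta_leviCivita_xi, zero_smul,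
    sub_zero] at h1
  rw [h1]
  simp only [map_add, map_sub, map_neg, map_smul]
  module

/-- ∇_ξφ is minus the anticommutator of ∇ξ + φ and φ, which vanishes. -/
lemma leviCivita_phi {Y : Π x : M, TangentSpace I x} {x : M} (hY : CMDiffAt ∞ (T% Y) x) :
    leviCivita S.metric (fun y ↦ S.phi y (Y y)) x (S.xi x) =
      S.phi x (leviCivita S.metric Y x (S.xi x)) := by
  rw [← sub_eq_zero, S.leviCivita_phi_xi hY]
  have := S.phi_leviCivita_xi_add_phi x (Y x)
  rw [map_add] at this
  rw [eq_sub_of_add_eq this]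
  module

/-- Since ∇_ξφ = 0, L_ξφ is the commutator of φ with ∇ξ, equivalently with ∇ξ + φ. As the latter
anticommutes with φ, half the commutator is the product. -/
lemma h_eq (x : M) (v : TangentSpace I x) :
    S.h x v = S.phi x (leviCivita S.metric S.xi x v + S.phi x v) := by
  have hY := FiberBundle.contMDiffAt_extend I E (k := ∞) v
  set Y := FiberBundle.extend E v with hYdef
  have hv : v = Y x := by simp [hYdef]
  have hξ := S.mdifferentiableAt_xi x
  have hY' : MDiffAt (T% Y) x := hY.mdifferentiableAt (by simp)
  rw [hv, S.h_apply hY', lieDerivEndo, ← leviCivita_torsion S.metric hξ hY',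
    ← leviCivita_torsion S.metric hξ (S.mdifferentiableAt_phi hY'), S.leviCivita_phi hY, map_sub]
  have := S.phi_leviCivita_xi_add_phi x (Y x)
  rw [map_add] at this ⊢
  rw [eq_sub_of_add_eq this]
  module

lemma leviCivita_xi (x : M) (v : TangentSpace I x) :
    leviCivita S.metric S.xi x v = S.phi x (S.h x v) - S.phi x v := by
  rw [S.h_eq, S.phi_phi, map_add, S.eta_leviCivita_xi, S.eta_phi]
  simp

lemma h_phi (x : M) (v : TangentSpace I x) : S.h x (S.phi x v) = -S.phi x (S.h x v) := by
  rw [S.h_eq x v, S.phi_leviCivita_xi_add_phi, S.h_eq, map_neg, neg_neg]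

lemma h_xi (x : M) : S.h x (S.xi x) = 0 := by
  rw [S.h_eq, S.leviCivita_xi_xi, S.phi_xi]
  simp

lemma eta_h (x : M) (v : TangentSpace I x) : S.eta x (S.h x v) = 0 := by
  rw [S.h_eq, S.eta_phi]

/-- h is the product of the skew φ and the self-adjoint ∇ξ + φ, which anticommute. -/
lemma inner_h_left (x : M) (v w : TangentSpace I x) :
    S.metric.inner x (S.h x v) w = S.metric.inner x v (S.h x w) := by
  have h1 := S.inner_leviCivita_xi_sub x v (S.phi x w)
  rw [S.leviCivita_xi, S.leviCivita_xi, S.h_phi, S.phi_phi x w] at h1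
  simp only [map_sub, map_neg, map_smul, _root_.sub_apply, S.phi_phi, S.inner_phi_left,
    S.inner_xi_right, S.eta_h, map_zero, smul_eq_mul, zero_smul] at h1
  linarith

end ParacontactMetricStructure

lemma leviCivita_neg (g : SemiRiemannianMetric I M) {Y : Π x : M, TangentSpace I x} {x : M}
    (hY : MDiffAt (T% Y) x) : leviCivita g (-Y) x = -leviCivita g Y x := by
  simpa using (leviCivita g).isCovariantDerivativeOnUniv.smul_const (-1 : ℝ) hY

lemma leviCivita_sub (g : SemiRiemannianMetric I M) {Y Z : Π x : M, TangentSpace I x} {x : M}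
    (hY : MDiffAt (T% Y) x) (hZ : MDiffAt (T% Z) x) :
    leviCivita g (Y - Z) x = leviCivita g Y x - leviCivita g Z x := by
  rw [sub_eq_add_neg, (leviCivita g).isCovariantDerivativeOnUniv.add hY
    (mdifferentiableAt_neg_section hZ), leviCivita_neg g hZ, sub_eq_add_neg]

namespace AlmostParacontactStructure

lemma contMDiffAt_h (S : AlmostParacontactStructure I M n) {X : Π x : M, TangentSpace I x} {x : M}
    (hX : CMDiffAt ∞ (T% X) x) : CMDiffAt ∞ (T% (fun y ↦ S.h y (X y))) x := by
  have hξ : CMDiffAt ∞ (T% S.xi) x := S.contMDiff_xi.contMDiffAt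
  have h1 := ContMDiffAt.smul_section (contMDiffAt_const (c := (1 / 2 : ℝ)))
    ((contMDiffAt_mlieBracket hξ (S.contMDiffAt_phi hX)).sub_section
      (S.contMDiffAt_phi (contMDiffAt_mlieBracket hξ hX)))
  refine h1.congr_of_eventuallyEq ?_
  filter_upwards [eventually_mdifferentiableAt_of_contMDiffAt hX] with y hy
  rw [S.h_apply hy]
  rfl

end AlmostParacontactStructure

/-! ### The nullity condition: h² = 0, and normality when h = 0 -/

namespace ParacontactMetricStructure

variable (S : ParacontactMetricStructure I M n)

/-- The Jacobi operator of the characteristic vector field. -/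
lemma curvature_xi_xi {X : Π x : M, TangentSpace I x} {x : M} (hX : CMDiffAt ∞ (T% X) x) :
    curvature S.metric S.xi X S.xi x =
      S.phi x (leviCivita S.metric (fun y ↦ S.h y (X y)) x (S.xi x)
        - S.h x (leviCivita S.metric X x (S.xi x)))
      + S.phi x (S.phi x (X x)) - S.h x (S.h x (X x)) := by
  have hX' : MDiffAt (T% X) x := hX.mdifferentiableAt (by simp)
  have hh := S.contMDiffAt_h hX
  have e1 : (fun y ↦ leviCivita S.metric S.xi y (X y)) =
      fun y ↦ S.phi y (((fun z ↦ S.h z (X z)) - X) y) := by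
    ext y
    rw [S.leviCivita_xi, Pi.sub_apply, map_sub]
  have e2 : (fun y ↦ leviCivita S.metric S.xi y (S.xi y)) = 0 := funext S.leviCivita_xi_xi
  rw [curvature, e1, e2, S.leviCivita_phi (hh.sub_section hX),
    leviCivita_sub S.metric (hh.mdifferentiableAt (by simp)) hX', CovariantDerivative.zero,
    ← leviCivita_torsion S.metric (S.mdifferentiableAt_xi x) hX']
  simp only [S.leviCivita_xi, map_sub, S.h_phi, S.phi_phi x (S.h x (S.h x (X x))), S.eta_h,
    _root_.sub_apply, Pi.zero_apply, _root_.zero_apply, map_neg]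
  module

/-- φ(∇_ξh) anticommutes with φ, because h does and φ is parallel along ξ. -/
lemma phi_leviCivita_h_phi {X : Π x : M, TangentSpace I x} {x : M} (hX : CMDiffAt ∞ (T% X) x) :
    S.phi x (leviCivita S.metric (fun y ↦ S.h y (S.phi y (X y))) x (S.xi x)
        - S.h x (leviCivita S.metric (fun y ↦ S.phi y (X y)) x (S.xi x))) =
      -S.phi x (S.phi x (leviCivita S.metric (fun y ↦ S.h y (X y)) x (S.xi x)
        - S.h x (leviCivita S.metric X x (S.xi x)))) := by
  have hh := S.contMDiffAt_h hX
  have e1 : (fun y ↦ S.h y (S.phi y (X y))) = -fun y ↦ S.phi y (S.h y (X y)) :=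
    funext fun y ↦ S.h_phi y (X y)
  rw [e1, leviCivita_neg S.metric ((S.contMDiffAt_phi hh).mdifferentiableAt (by simp)),
    _root_.neg_apply, S.leviCivita_phi hh, S.leviCivita_phi hX, S.h_phi]
  simp only [map_sub, map_neg]
  module

variable {S} in
lemma IsKappaMuSpace.h_h {μ : ℝ} (hS : S.IsKappaMuSpace (-1) μ) (x : M) (v : TangentSpace I x) :
    S.h x (S.h x v) = 0 := by
  have key {X : Π x : M, TangentSpace I x} (hX : CMDiffAt ∞ (T% X) x) :
      S.phi x (leviCivita S.metric (fun y ↦ S.h y (X y)) x (S.xi x)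
        - S.h x (leviCivita S.metric X x (S.xi x))) =
      S.h x (S.h x (X x)) - μ • S.h x (X x) := by
    have h1 := hS x S.xi X S.contMDiff_xi.contMDiffAt hX
    rw [S.curvature_xi_xi hX, S.eta_xi, S.h_xi, S.phi_phi] at h1
    rw [← sub_eq_zero] at h1 ⊢
    rw [← h1]
    module
  have hX := FiberBundle.contMDiffAt_extend I E (k := ∞) v
  set X := FiberBundle.extend E v with hXdef
  have hv : v = X x := by simp [hXdef]
  have h1 := S.phi_leviCivita_h_phi hX
  rw [key hX, key (S.contMDiffAt_phi hX), S.h_phi, map_neg, S.h_phi, map_sub, map_smul] at h1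
  -- In φ(∇_ξh) = h² - μh only h² commutes with φ, so the anticommutator with φ retains only twice
  -- φh².
  have h2 : (2 : ℝ) • S.phi x (S.h x (S.h x (X x))) = 0 := by
    rw [← sub_eq_zero] at h1
    rw [← h1]
    module
  have h3 := congrArg (S.phi x) ((smul_eq_zero_iff_right (two_ne_zero (α := ℝ))).1 h2)
  rw [S.phi_phi, S.eta_h, zero_smul, sub_zero, map_zero] at h3
  rw [hv, h3]

/-- The covariant derivative of `φ`. -/
def covDerivPhi (X Y : Π x : M, TangentSpace I x) (x : M) : TangentSpace I x :=
  leviCivita S.metric (fun y ↦ S.phi y (Y y)) x (X x) - S.phi x (leviCivita S.metric Y x (X x))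

/-- ∇_Xφ inherits skewness from φ, the metric being parallel. -/
lemma inner_covDerivPhi {X Y Z : Π x : M, TangentSpace I x} {x : M} (hX : MDiffAt (T% X) x)
    (hY : MDiffAt (T% Y) x) (hZ : MDiffAt (T% Z) x) :
    S.metric.inner x (S.covDerivPhi X Y x) (Z x) =
      -S.metric.inner x (S.covDerivPhi X Z x) (Y x) := by
  have h1 := leviCivita_metric S.metric hX (S.mdifferentiableAt_phi hY) hZ
  have h2 := leviCivita_metric S.metric hX hY (S.mdifferentiableAt_phi hZ)
  have h3 : (fun y ↦ S.metric.inner y (S.phi y (Y y)) (Z y)) =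
      fun y ↦ -S.metric.inner y (Y y) (S.phi y (Z y)) := funext fun y ↦ S.inner_phi_left ..
  have h4 : d% (fun y ↦ -S.metric.inner y (Y y) (S.phi y (Z y))) x =
    -d% (fun y ↦ S.metric.inner y (Y y) (S.phi y (Z y))) x := mvfderiv_fun_neg
  rw [h3, h4, _root_.neg_apply, h2] at h1
  simp only [covDerivPhi, map_sub, _root_.sub_apply, S.inner_phi_left] at h1 ⊢
  rw [S.metric.symm x (leviCivita S.metric (fun y ↦ S.phi y (Z y)) x (X x)),
    S.metric.symm x (leviCivita S.metric Z x (X x)), S.inner_phi_left x (Y x)]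
  linarith

lemma nijenhuis_eq {X Y : Π x : M, TangentSpace I x} {x : M} (hX : MDiffAt (T% X) x)
    (hY : MDiffAt (T% Y) x) :
    nijenhuis S.phi X Y x =
      S.covDerivPhi (fun y ↦ S.phi y (X y)) Y x - S.covDerivPhi (fun y ↦ S.phi y (Y y)) X x
        + S.phi x (S.covDerivPhi Y X x) - S.phi x (S.covDerivPhi X Y x) := by
  have hφX := S.mdifferentiableAt_phi hX
  have hφY := S.mdifferentiableAt_phi hY
  rw [nijenhuis, ← leviCivita_torsion S.metric hX hY, ← leviCivita_torsion S.metric hφX hφY,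
    ← leviCivita_torsion S.metric hφX hY, ← leviCivita_torsion S.metric hX hφY]
  simp only [covDerivPhi, map_sub]
  module

variable {S} in
lemma IsKappaMuSpace.covDerivPhi_of_h_eq_zero {μ : ℝ} (hS : S.IsKappaMuSpace (-1) μ)
    (hh : S.h = 0) {X Y : Π x : M, TangentSpace I x} {x : M} (hX : CMDiffAt ∞ (T% X) x)
    (hY : CMDiffAt ∞ (T% Y) x) :
    S.covDerivPhi X Y x = S.eta x (Y x) • X x - S.metric.inner x (X x) (Y x) • S.xi x := by
  have hA (y : M) (v : TangentSpace I y) : leviCivita S.metric S.xi y v = -S.phi y v := by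
    rw [S.leviCivita_xi, hh]
    simp
  -- For ∇ξ = -φ, R(X, Y)ξ is minus the alternation of ∇φ. Being skew in its last two slots, ∇φ is
  -- recovered by the cyclic combination that proves uniqueness of the Levi-Civita connection.
  have key {X Y : Π x : M, TangentSpace I x} (hX : CMDiffAt ∞ (T% X) x)
      (hY : CMDiffAt ∞ (T% Y) x) : S.covDerivPhi X Y x - S.covDerivPhi Y X x =
        S.eta x (Y x) • X x - S.eta x (X x) • Y x := by
    have h1 := hS x X Y hX hY
    have e (Z : Π x : M, TangentSpace I x) : (fun y ↦ leviCivita S.metric S.xi y (Z y)) =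
      -fun y ↦ S.phi y (Z y) := funext fun y ↦ hA y (Z y)
    have hX' : MDiffAt (T% X) x := hX.mdifferentiableAt (by simp)
    have hY' : MDiffAt (T% Y) x := hY.mdifferentiableAt (by simp)
    rw [curvature, e, e, leviCivita_neg S.metric (S.mdifferentiableAt_phi hX'),
      leviCivita_neg S.metric (S.mdifferentiableAt_phi hY'), hA,
      ← leviCivita_torsion S.metric hX' hY', hh] at h1
    simp only [_root_.neg_apply, map_sub, Pi.zero_apply, _root_.zero_apply, smul_zero] at h1
    rw [← sub_eq_zero] at h1 ⊢
    rw [← neg_eq_zero, ← h1]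
    simp only [covDerivPhi]
    module
  rw [← sub_eq_zero]
  refine S.metric.nondegenerate x _ fun w ↦ ?_
  have hZ := FiberBundle.contMDiffAt_extend I E (k := ∞) w
  set Z := FiberBundle.extend E w with hZdef
  have hw : w = Z x := by simp [hZdef]
  rw [hw]
  have hX' : MDiffAt (T% X) x := hX.mdifferentiableAt (by simp)
  have hY' : MDiffAt (T% Y) x := hY.mdifferentiableAt (by simp)
  have hZ' : MDiffAt (T% Z) x := hZ.mdifferentiableAt (by simp)
  have k1 := congrArg (fun v ↦ S.metric.inner x v (Z x)) (key hX hY)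
  have k2 := congrArg (fun v ↦ S.metric.inner x v (X x)) (key hY hZ)
  have k3 := congrArg (fun v ↦ S.metric.inner x v (Y x)) (key hZ hX)
  have s1 := S.inner_covDerivPhi hX' hY' hZ'
  have s2 := S.inner_covDerivPhi hY' hZ' hX'
  have s3 := S.inner_covDerivPhi hZ' hX' hY'
  simp only [map_sub, map_smul, _root_.sub_apply, _root_.smul_apply, smul_eq_mul,
    S.inner_xi_left] at k1 k2 k3 ⊢
  rw [S.metric.symm x (Z x) (X x)] at k2
  rw [S.metric.symm x (Z x) (Y x), S.metric.symm x (X x) (Y x)] at k3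
  rw [S.metric.symm x (Y x) (X x)] at k2 k3
  linarith

variable {S} in
lemma IsKappaMuSpace.isParaSasakian_of_h_eq_zero {μ : ℝ} (hS : S.IsKappaMuSpace (-1) μ)
    (hh : S.h = 0) : S.IsParaSasakian := by
  intro x X Y hX hY
  rw [S.nijenhuis_eq (hX.mdifferentiableAt (by simp)) (hY.mdifferentiableAt (by simp)),
    hS.covDerivPhi_of_h_eq_zero hh hX hY, hS.covDerivPhi_of_h_eq_zero hh hY hX,
    hS.covDerivPhi_of_h_eq_zero hh (S.contMDiffAt_phi hX) hY,
    hS.covDerivPhi_of_h_eq_zero hh (S.contMDiffAt_phi hY) hX, S.extDeriv_eta x X Y hX hY]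
  simp only [map_sub, map_smul, S.phi_xi, S.inner_phi_left,
    S.metric.symm x (Y x) (S.phi x (X x))]
  module

end ParacontactMetricStructure

/-! ### Linear algebra: dual bases, rescaling, independence -/

section DualBases

variable {U W : Type*} [AddCommGroup U] [Module ℝ U] [FiniteDimensional ℝ U]
  [AddCommGroup W] [Module ℝ W] [FiniteDimensional ℝ W]

lemma exists_dual_basis_of_injective {ι : Type*} [Fintype ι] [DecidableEq ι]
    (g : U →ₗ[ℝ] W →ₗ[ℝ] ℝ) (hg : Function.Injective g) (hUW : finrank ℝ U = finrank ℝ W)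
    (f : Basis ι ℝ W) : ∃ e : Basis ι ℝ U, ∀ i j, g (e i) (f j) = if i = j then 1 else 0 := by
  let G : U ≃ₗ[ℝ] Module.Dual ℝ W := LinearEquiv.ofInjectiveOfFinrankEq g hg
    (hUW.trans Subspace.dual_finrank_eq.symm)
  have hG (u : U) : G u = g u := rfl
  refine ⟨f.dualBasis.map G.symm, fun i j ↦ ?_⟩
  rw [← hG, Basis.map_apply, LinearEquiv.apply_symm_apply, Basis.dualBasis_apply_self]
  simp [eq_comm]

/-- Let `U` and `W` be in duality, and let `a : U → W` and `b : W → U` be symmetric maps with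
`b ∘ a = 0`. Then there are dual bases in which both maps are diagonal. -/
lemma exists_dual_bases_diagonal (hUW : finrank ℝ U = finrank ℝ W)
    (g : U →ₗ[ℝ] W →ₗ[ℝ] ℝ) (hg : Function.Injective g) (hg' : Function.Injective g.flip)
    (a : U →ₗ[ℝ] W) (b : W →ₗ[ℝ] U) (ha : ∀ u u', g u (a u') = g u' (a u))
    (hb : ∀ w w', g (b w) w' = g (b w') w) (hba : ∀ u, b (a u) = 0) :
    ∃ (e : Basis (Fin (finrank ℝ W)) ℝ U) (f : Basis (Fin (finrank ℝ W)) ℝ W)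
      (α β : Fin (finrank ℝ W) → ℝ), (∀ i j, g (e i) (f j) = if i = j then 1 else 0) ∧
      (∀ i, a (e i) = α i • f i) ∧ ∀ i, b (f i) = β i • e i := by
  classical
  have : Invertible (2 : ℝ) := invertibleOfNonzero two_ne_zero
  -- First diagonalize the form g(u, a u') alone; `b` then kills every `f₁ i` with `α₁ i ≠ 0`.
  obtain ⟨e₁, he₁⟩ := LinearMap.BilinForm.exists_orthogonal_basis
    (B := g.compl₂ a) ⟨fun u u' ↦ by simpa using ha u u'⟩
  obtain ⟨f₁, hf₁⟩ := exists_dual_basis_of_injective g.flip hg' hUW.symm e₁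
  simp only [LinearMap.flip_apply] at hf₁
  let α₁ i := g (e₁ i) (a (e₁ i))
  have ha₁ (i) : a (e₁ i) = α₁ i • f₁ i := by
    refine hg' (e₁.ext fun j ↦ ?_)
    rcases eq_or_ne i j with rfl | hij
    · simp [hf₁, α₁]
    · have : g (e₁ j) (a (e₁ i)) = 0 := by simpa using he₁ (Ne.symm hij)
      simp [hf₁, this, hij]
  have hb₁ (i) (hi : α₁ i ≠ 0) : b (f₁ i) = 0 := by
    have := hba (e₁ i)
    rwa [ha₁, map_smul, smul_eq_zero, or_iff_right hi] at this
  let K := {i // α₁ i = 0}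
  let K' := {i // ¬ α₁ i = 0}
  let Φ : ((K → ℝ) × (K' → ℝ)) ≃ₗ[ℝ] W := (LinearEquiv.sumArrowLequivProdArrow K K' ℝ ℝ).symm ≪≫ₗ
    (f₁.reindex (Equiv.sumCompl fun i ↦ α₁ i = 0).symm).equivFun.symm
  have hΦ (i : K') : Φ (0, Pi.single i 1) = f₁ i := by
    simp [Φ, Basis.equivFun_symm_apply, Fintype.sum_sum_type, Pi.single_apply]
  let ψ : (K → ℝ) →ₗ[ℝ] W := Φ.toLinearMap ∘ₗ LinearMap.inl ℝ _ _
  -- The remaining `f₁ i` span a complement to part of the radical of g(b w, w'). Changing basis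
  -- only there diagonalizes `b` without disturbing the range of `a`, so `a` remains diagonal after
  -- dualizing again.
  obtain ⟨q, hq⟩ := LinearMap.BilinForm.exists_orthogonal_basis
    (B := (g ∘ₗ b).compl₁₂ ψ ψ) ⟨fun w w' ↦ by simpa using hb (ψ w) (ψ w')⟩
  let f₂ := (q.prod (Pi.basisFun ℝ K')).map Φ
  have hf₂l (i) : f₂ (.inl i) = ψ (q i) := by simp [f₂, ψ]
  have hf₂r (i) : f₂ (.inr i) = f₁ i := by simp [f₂, hΦ]
  obtain ⟨e₂, he₂⟩ := exists_dual_basis_of_injective g hg hUW f₂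
  let β₂ j := g (b (f₂ j)) (f₂ j)
  have hbr (i) : b (f₂ (.inr i)) = 0 := by rw [hf₂r, hb₁ _ i.2]
  have hb₂ (j) : b (f₂ j) = β₂ j • e₂ j := by
    refine hg (f₂.ext fun k ↦ ?_)
    rcases eq_or_ne j k with rfl | hjk
    · simp [he₂, β₂]
    · have : g (b (f₂ j)) (f₂ k) = 0 := by
        rcases j with j | j
        · rcases k with k | k
          · have hjk' : j ≠ k := fun h ↦ hjk (by rw [h])
            rw [hf₂l, hf₂l]
            simpa using hq hjk'
          · rw [hb, hbr]
            simp
        · rw [hbr]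
          simp
      simp [he₂, this, hjk]
  let α₂ : Fin (finrank ℝ (K → ℝ)) ⊕ K' → ℝ := Sum.elim (fun _ ↦ 0) (fun i ↦ α₁ i)
  have ha₂ (j) : a (e₂ j) = α₂ j • f₂ j := by
    refine hg' (e₁.ext fun i ↦ ?_)
    simp only [LinearMap.flip_apply, map_smul]
    rw [ha, ha₁, map_smul, smul_eq_mul]
    by_cases hi : α₁ i = 0
    · rcases j with j | j
      · simp [α₂, hi]
      · have : j.1 ≠ i := fun h ↦ j.2 (h ▸ hi)
        simp [α₂, hi, hf₂r, hf₁, this]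
    · rw [← hf₂r ⟨i, hi⟩, he₂]
      rcases j with j | j
      · simp [α₂]
      · rcases eq_or_ne j ⟨i, hi⟩ with rfl | hj
        · simp [α₂, hf₂r, hf₁]
        · have : j.1 ≠ i := fun h ↦ hj (Subtype.ext h)
          simp [α₂, hf₂r, hf₁, this, hj]
  have hcard := Module.finrank_eq_card_basis f₂
  let r := (Fintype.equivFinOfCardEq hcard.symm)
  refine ⟨e₂.reindex r, f₂.reindex r, α₂ ∘ r.symm, β₂ ∘ r.symm, fun i j ↦ ?_, fun i ↦ ?_,
    fun i ↦ ?_⟩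
  · simp [he₂]
  · simp [ha₂]
  · simp [hb₂]

end DualBases

section HyperbolicFamily

variable {V : Type*} [AddCommGroup V] [Module ℝ V]

lemma exists_mul_self_mul_eq {r : ℝ} (hr : r ≠ 0) : ∃ s : ℝ, s * s * r = 1 ∨ s * s * r = -1 := by
  refine ⟨(√|r|)⁻¹, ?_⟩
  have h1 : (√|r|)⁻¹ * (√|r|)⁻¹ = |r|⁻¹ := by
    rw [← mul_inv, Real.mul_self_sqrt (abs_nonneg r)]
  rw [h1]
  rcases abs_cases r with ⟨h, -⟩ | ⟨h, -⟩ <;> rw [h]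
  · left; field_simp
  · right; field_simp

/-- h² = 0 forces αβ = 0, so at most one arrow survives, and its source becomes X. The product `c *
d` will be g(X, Y) when e and f are dual null vectors. -/
lemma exists_hyperbolic_pair (h : V →ₗ[ℝ] V) {e f : V} {α β : ℝ} (he : h e = α • f)
    (hf : h f = β • e) (hh : ∀ v, h (h v) = 0) :
    ∃ (X Y : V) (c d : ℝ), (c * d = 1 ∨ c * d = -1) ∧
      ((X = c • e ∧ Y = d • f) ∨ (X = c • f ∧ Y = d • e)) ∧
      ((h X = Y ∧ h Y = 0) ∨ (h X = 0 ∧ h Y = 0)) := by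
  by_cases hβ : β = 0
  · by_cases hα : α = 0
    · exact ⟨e, f, 1, 1, by simp, by simp, by simp [he, hf, hα, hβ]⟩
    · obtain ⟨s, hs⟩ := exists_mul_self_mul_eq hα
      -- The second factor is forced by h X = Y; then s = 1/√|α| makes the product ±1.
      refine ⟨s • e, (s * α) • f, s, s * α, by simpa [mul_assoc] using hs, by simp, .inl ?_⟩
      simp [he, hf, hβ, smul_smul]
  · obtain ⟨s, hs⟩ := exists_mul_self_mul_eq hβ
    have hα : h e = 0 := by
      have := hh f
      rwa [hf, map_smul, smul_eq_zero, or_iff_right hβ] at this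
    refine ⟨s • f, (s * β) • e, s, s * β, by simpa [mul_assoc] using hs, by simp, .inl ?_⟩
    simp [hf, hα, smul_smul]

end HyperbolicFamily

section Gram

variable {V : Type*} [AddCommGroup V] [Module ℝ V]

lemma linearIndependent_of_separating {ι : Type*} [Fintype ι] {b : ι → V} (L : ι → V →ₗ[ℝ] ℝ)
    (h0 : ∀ i j, i ≠ j → L i (b j) = 0) (h1 : ∀ i, L i (b i) ≠ 0) : LinearIndependent ℝ b := by
  classical
  rw [Fintype.linearIndependent_iff]
  intro c hc i
  have := congrArg (L i) hc
  rw [map_sum, Finset.sum_eq_single i (fun j _ hj ↦ by rw [map_smul, h0 i j hj.symm, smul_zero])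
    (by simp), map_smul, map_zero, smul_eq_mul] at this
  exact (mul_eq_zero.1 this).resolve_right (h1 i)

end Gram

/-! ### Eigenspaces of φ and adapted bases -/

namespace AlmostParacontactStructure

variable (S : AlmostParacontactStructure I M n)

lemma mem_eigenspace_one {x : M} {v : TangentSpace I x} :
    v ∈ Module.End.eigenspace (S.phi x).toLinearMap (1 : ℝ) ↔ S.phi x v = v := by
  simp

lemma mem_eigenspace_neg_one {x : M} {v : TangentSpace I x} :
    v ∈ Module.End.eigenspace (S.phi x).toLinearMap (-1 : ℝ) ↔ S.phi x v = -v := by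
  simp

end AlmostParacontactStructure

namespace ParacontactMetricStructure

variable (S : ParacontactMetricStructure I M n)

/-- The metric as a bilinear form. -/
def bilin (p : M) : TangentSpace I p →ₗ[ℝ] TangentSpace I p →ₗ[ℝ] ℝ :=
  LinearMap.mk₂ ℝ (fun v w ↦ S.metric.inner p v w) (by simp) (by simp) (by simp) (by simp)

lemma bilin_apply (p : M) (v w : TangentSpace I p) : S.bilin p v w = S.metric.inner p v w := rfl

lemma inner_eq_zero_of_phi_eq {p : M} {v w : TangentSpace I p} {c : ℝ} (hc : c ≠ 0)
    (hv : S.phi p v = c • v) (hw : S.phi p w = c • w) : S.metric.inner p v w = 0 := by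
  have h1 := S.inner_phi_left p v w
  rw [hv, hw] at h1
  simp only [map_smul, _root_.smul_apply, smul_eq_mul] at h1
  have h2 : c * S.metric.inner p v w = 0 := by linarith
  exact (mul_eq_zero.1 h2).resolve_left hc

lemma eq_zero_of_inner_eigenspace {p : M} {v : TangentSpace I p} {c : ℝ} (hc : c * c = 1)
    (hv : S.phi p v = c • v)
    (h : ∀ w, S.phi p w = -c • w → S.metric.inner p v w = 0) : v = 0 := by
  refine S.metric.nondegenerate p v fun w ↦ ?_
  -- This vector is twice the projection of w to the -c eigenspace.
  have h1 := h (S.phi p (S.phi p w) - c • S.phi p w) (by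
    rw [map_sub, S.phi_phi_phi, map_smul, smul_sub, smul_smul, neg_mul, hc]
    module)
  have h2 := S.inner_phi_left p v w
  have h3 := S.inner_phi_left p v (S.phi p w)
  rw [hv] at h2 h3
  simp only [map_smul, map_sub, _root_.smul_apply, smul_eq_mul] at h1 h2 h3
  have h4 : (c * c) * S.metric.inner p v w = 0 := by 
    linear_combination c * h2 + h1 / 2 - h3 / 2
  rwa [hc, one_mul] at h4

/-- Anticommuting with φ, h exchanges the two eigenspaces. They are in duality under g, and the two
restrictions of h are symmetric with composite zero. -/
lemma exists_dual_eigenbases (hh : ∀ (x : M) (v : TangentSpace I x), S.h x (S.h x v) = 0) (p : M) :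
    ∃ (e f : Fin n → TangentSpace I p) (α β : Fin n → ℝ),
      (∀ i, S.phi p (e i) = e i) ∧ (∀ i, S.phi p (f i) = -f i) ∧
      (∀ i j, S.metric.inner p (e i) (f j) = if i = j then 1 else 0) ∧
      (∀ i, S.h p (e i) = α i • f i) ∧ (∀ i, S.h p (f i) = β i • e i) := by
  have : FiniteDimensional ℝ (TangentSpace I p) := inferInstanceAs (FiniteDimensional ℝ E)
  set U := Module.End.eigenspace (S.phi p).toLinearMap (1 : ℝ) with hU
  set W := Module.End.eigenspace (S.phi p).toLinearMap (-1 : ℝ) with hW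
  have hUn : finrank ℝ U = n := S.finrank_eigenspace_one p
  have hWn : finrank ℝ W = n := S.finrank_eigenspace_neg_one p
  have mU (v : TangentSpace I p) : v ∈ U ↔ S.phi p v = v := S.mem_eigenspace_one
  have mW (v : TangentSpace I p) : v ∈ W ↔ S.phi p v = -v := S.mem_eigenspace_neg_one
  let a : U →ₗ[ℝ] W := (S.h p).toLinearMap.restrict fun v hv ↦ (mW _).2 <| by
    have h1 := S.h_phi p v
    rw [(mU v).1 hv] at h1
    simpa using (neg_eq_iff_eq_neg.2 h1).symm
  let b : W →ₗ[ℝ] U := (S.h p).toLinearMap.restrict fun v hv ↦ (mU _).2 <| by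
    have h1 := S.h_phi p v
    rw [(mW v).1 hv, map_neg, neg_inj] at h1
    exact h1.symm
  let g : U →ₗ[ℝ] W →ₗ[ℝ] ℝ := (S.bilin p).compl₁₂ U.subtype W.subtype
  have hgapp (u : U) (w : W) : g u w = S.metric.inner p u w := rfl
  have haapp (u : U) : (a u : TangentSpace I p) = S.h p u := rfl
  have hbapp (w : W) : (b w : TangentSpace I p) = S.h p w := rfl
  have hg : Function.Injective g := by
    rw [← LinearMap.ker_eq_bot, LinearMap.ker_eq_bot']
    intro u hu
    refine Subtype.ext (S.eq_zero_of_inner_eigenspace (c := 1) (by simp)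
      (by simpa using (mU _).1 u.2) fun w hw ↦ ?_)
    have := congrArg (fun L ↦ L ⟨w, (mW w).2 (by simpa using hw)⟩) hu
    simpa [hgapp] using this
  have hg' : Function.Injective g.flip := by
    rw [← LinearMap.ker_eq_bot, LinearMap.ker_eq_bot']
    intro u hu
    refine Subtype.ext (S.eq_zero_of_inner_eigenspace (c := -1) (by simp)
      (by simpa using (mW _).1 u.2) fun w hw ↦ ?_)
    have := congrArg (fun L ↦ L ⟨w, (mU w).2 (by simpa using hw)⟩) hu
    rw [S.metric.symm]
    simpa [hgapp] using this
  obtain ⟨e, f, α, β, h1, h2, h3⟩ := exists_dual_bases_diagonal (hUn.trans hWn.symm) g hg hg' a b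
    (fun u u' ↦ by rw [hgapp, hgapp, haapp, haapp, ← S.inner_h_left, S.metric.symm])
    (fun w w' ↦ by rw [hgapp, hgapp, hbapp, hbapp, S.inner_h_left, S.metric.symm])
    (fun u ↦ Subtype.ext (by rw [hbapp, haapp, hh]; rfl))
  let r : Fin n ≃ Fin (finrank ℝ W) := finCongr hWn.symm
  refine ⟨fun i ↦ e (r i), fun i ↦ f (r i), α ∘ r, β ∘ r, fun i ↦ (mU _).1 (e _).2,
    fun i ↦ (mW _).1 (f _).2, fun i j ↦ ?_, fun i ↦ ?_, fun i ↦ ?_⟩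
  · rw [← hgapp, h1]
    simp
  · rw [← haapp, h2]
    rfl
  · rw [← hbapp, h3]
    rfl

lemma ncard_blocks_eq_rankH {p : M} {b : Basis (Unit ⊕ (Fin n ⊕ Fin n)) ℝ (TangentSpace I p)}
    (hξ : b (.inl ()) = S.xi p)
    (hb : ∀ i, (S.h p (b (.inr (.inl i))) = b (.inr (.inr i)) ∧ S.h p (b (.inr (.inr i))) = 0) ∨
      (S.h p (b (.inr (.inl i))) = 0 ∧ S.h p (b (.inr (.inr i))) = 0)) :
    {i : Fin n | S.h p (b (.inr (.inl i))) = b (.inr (.inr i))}.ncard = S.rankH p := by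
  classical
  set s := {i : Fin n | S.h p (b (.inr (.inl i))) = b (.inr (.inr i))}
  -- The range of h is spanned by the independent vectors Y_i of the nonzero blocks, so its
  -- dimension counts them.
  have h1 : LinearMap.range (S.h p).toLinearMap =
      Submodule.span ℝ (Set.range fun i : s ↦ b (.inr (.inr i.1))) := by
    apply le_antisymm
    · rw [LinearMap.range_eq_map, ← b.span_eq, Submodule.map_span, Submodule.span_le]
      rintro - ⟨-, ⟨k, rfl⟩, rfl⟩
      rcases k with k | k | k
      · have : S.h p (b (.inl k)) = 0 := by
          rw [show b (.inl k) = S.xi p from hξ, S.h_xi]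
        simp [this]
      · rcases hb k with h | h
        · exact Submodule.subset_span ⟨⟨k, h.1⟩, h.1.symm⟩
        · simp [h.1]
      · have : S.h p (b (.inr (.inr k))) = 0 := (hb k).elim (·.2) (·.2)
        simp [this]
    · rw [Submodule.span_le]
      rintro - ⟨i, rfl⟩
      exact ⟨b (.inr (.inl i.1)), i.2⟩
  have h2 : LinearIndependent ℝ fun i : s ↦ b (.inr (.inr i.1)) :=
    b.linearIndependent.comp (fun i : s ↦ .inr (.inr i.1)) fun i j hij ↦ by
      simpa [Subtype.ext_iff] using hij
  rw [rankH, h1, finrank_span_eq_card h2, ← Nat.card_eq_fintype_card]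
  rfl

lemma exists_isAdaptedBasis (hE : finrank ℝ E = 2 * n + 1)
    (hh : ∀ (x : M) (v : TangentSpace I x), S.h x (S.h x v) = 0) (p : M) :
    ∃ b : Basis (Unit ⊕ (Fin n ⊕ Fin n)) ℝ (TangentSpace I p), S.IsAdaptedBasis p b := by
  have : FiniteDimensional ℝ (TangentSpace I p) := inferInstanceAs (FiniteDimensional ℝ E)
  obtain ⟨e, f, α, β, he, hf, hef, hhe, hhf⟩ := S.exists_dual_eigenbases hh p
  choose X Y c d hcd hXY hblock using fun i ↦
    exists_hyperbolic_pair (S.h p).toLinearMap (hhe i) (hhf i) (hh p)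
  have hfe (i j) : S.metric.inner p (f i) (e j) = if i = j then 1 else 0 := by
    rw [S.metric.symm, hef]
    simp [eq_comm]
  have hee (i j) : S.metric.inner p (e i) (e j) = 0 :=
    S.inner_eq_zero_of_phi_eq one_ne_zero (by simpa using he i) (by simpa using he j)
  have hff (i j) : S.metric.inner p (f i) (f j) = 0 :=
    S.inner_eq_zero_of_phi_eq (c := -1) (by simp) (by simpa using hf i) (by simpa using hf j)
  have hξe (i) : S.eta p (e i) = 0 := by rw [← he, S.eta_phi]
  have hξf (i) : S.eta p (f i) = 0 := by
    rw [← neg_neg (f i), ← hf, map_neg, S.eta_phi, neg_zero]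
  have hηX (i) : S.eta p (X i) = 0 := by
    rcases hXY i with h | h <;> simp [h.1, hξe, hξf]
  have hηY (i) : S.eta p (Y i) = 0 := by
    rcases hXY i with h | h <;> simp [h.2, hξe, hξf]
  have gXX (i j) : S.metric.inner p (X i) (X j) = 0 := by
    rcases eq_or_ne i j with rfl | hij
    · rcases hXY i with h | h <;> simp [h.1, hee, hff]
    · rcases hXY i with h | h <;> rcases hXY j with h' | h' <;>
        simp [h.1, h'.1, hee, hff, hef, hfe, hij]
  have gYY (i j) : S.metric.inner p (Y i) (Y j) = 0 := by
    rcases eq_or_ne i j with rfl | hij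
    · rcases hXY i with h | h <;> simp [h.2, hee, hff]
    · rcases hXY i with h | h <;> rcases hXY j with h' | h' <;>
        simp [h.2, h'.2, hee, hff, hef, hfe, hij]
  have gXY (i j) (hij : i ≠ j) : S.metric.inner p (X i) (Y j) = 0 := by
    rcases hXY i with h | h <;> rcases hXY j with h' | h' <;>
      simp [h.1, h'.2, hee, hff, hef, hfe, hij]
  have gXYi (i) : S.metric.inner p (X i) (Y i) = 1 ∨ S.metric.inner p (X i) (Y i) = -1 := by
    have : S.metric.inner p (X i) (Y i) = c i * d i := by
      rcases hXY i with h | h <;> simp [h.1, h.2, hef, hfe, mul_comm]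
    rw [this]
    exact hcd i
  have gXYne (i) : S.metric.inner p (X i) (Y i) ≠ 0 := by
    rcases gXYi i with h | h <;> simp [h]
  let v : Unit ⊕ (Fin n ⊕ Fin n) → TangentSpace I p :=
    Sum.elim (fun _ ↦ S.xi p) (Sum.elim X Y)
  have hv : LinearIndependent ℝ v := by
    -- The functional isolating X_i is pairing with Y_i, and conversely; ξ is isolated by η.
    refine linearIndependent_of_separating (fun k ↦ S.bilin p
      ((Sum.elim (fun _ ↦ S.xi p) (Sum.elim Y X) : _ → TangentSpace I p) k)) ?_ ?_
    · rintro (i | i | i) (j | j | j) hij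
      · exact (hij rfl).elim
      all_goals simp only [Sum.elim_inl, Sum.elim_inr, v, bilin_apply, S.inner_xi_left,
        S.inner_xi_right, hηX, hηY, gXX, gYY]
      · rw [S.metric.symm]
        exact gXY _ _ fun h ↦ hij (by rw [h])
      · exact gXY _ _ fun h ↦ hij (by rw [h])
    · rintro (i | i | i)
      · simp [v, bilin_apply, S.inner_xi_left, S.eta_xi]
      · simpa [v, bilin_apply, S.metric.symm p (Y i)] using gXYne i
      · simpa [v, bilin_apply] using gXYne i
  have hcard : Fintype.card (Unit ⊕ (Fin n ⊕ Fin n)) = finrank ℝ (TangentSpace I p) := by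
    rw [show finrank ℝ (TangentSpace I p) = finrank ℝ E from rfl, hE]
    simp
    ring
  let b := basisOfLinearIndependentOfCardEqFinrank hv hcard
  have hb (k) : b k = v k := by simp [b]
  have bξ : b (.inl ()) = S.xi p := hb _
  have bX (i) : b (.inr (.inl i)) = X i := hb _
  have bY (i) : b (.inr (.inr i)) = Y i := hb _
  refine ⟨b, ⟨bξ, ?_, ?_, ?_, ?_, ?_, ?_, ?_, ?_, S.ncard_blocks_eq_rankH bξ ?_⟩⟩
  all_goals simp only [bX, bY, S.inner_xi_left]
  exacts [S.eta_xi p, hηX, hηY, gXX, gYY, gXY, gXYi, hblock, hblock]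

variable {S} in
lemma IsAdaptedBasis.rankH_le {p : M} {b : Basis (Unit ⊕ (Fin n ⊕ Fin n)) ℝ (TangentSpace I p)}
    (hb : S.IsAdaptedBasis p b) : S.rankH p ≤ n := by
  rw [← hb.card_blocks]
  simpa using Set.ncard_le_card {i : Fin n | S.h p (b (.inr (.inl i))) = b (.inr (.inr i))}

lemma one_le_rankH {p : M} (hp : S.h p ≠ 0) : 1 ≤ S.rankH p := by
  have : FiniteDimensional ℝ (TangentSpace I p) := inferInstanceAs (FiniteDimensional ℝ E)
  rw [Nat.one_le_iff_ne_zero, rankH, Ne, Submodule.finrank_eq_zero, LinearMap.range_eq_bot]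
  exact fun h ↦ hp (by ext v; exact congrArg (fun L ↦ L v) h)

/-! ### Adapted bases in dimension three -/

lemma IsAdaptedBasis.phi_eq {p : M} {S : ParacontactMetricStructure I M 1}
    {b : Basis (Unit ⊕ (Fin 1 ⊕ Fin 1)) ℝ (TangentSpace I p)} (hb : S.IsAdaptedBasis p b) :
    (S.phi p (b (.inr (.inl 0))) = b (.inr (.inl 0)) ∧
      S.phi p (b (.inr (.inr 0))) = -b (.inr (.inr 0))) ∨
    (S.phi p (b (.inr (.inl 0))) = -b (.inr (.inl 0)) ∧
      S.phi p (b (.inr (.inr 0))) = b (.inr (.inr 0))) := by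
  have hX := hb.metric_xi_X 0
  have hY := hb.metric_xi_Y 0
  have hXX := hb.metric_X_X 0 0
  have hYY := hb.metric_Y_Y 0 0
  have hXY : S.metric.inner p (b (.inr (.inl 0))) (b (.inr (.inr 0))) ≠ 0 := by
    rcases hb.metric_X_Y 0 with h | h <;> simp [h]
  have hexp (v : TangentSpace I p) : ∃ a b' c : ℝ,
      v = a • S.xi p + (b' • b (.inr (.inl 0)) + c • b (.inr (.inr 0))) := by
    refine ⟨b.repr v (.inl ()), b.repr v (.inr (.inl 0)), b.repr v (.inr (.inr 0)), ?_⟩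
    rw [← hb.xi_eq]
    have h := (b.sum_repr v).symm
    rwa [Fintype.sum_sum_type, Fintype.sum_sum_type, Fintype.sum_unique, Fintype.sum_unique,
      Fintype.sum_unique] at h
  rw [S.inner_xi_left] at hX hY
  set X := b (.inr (.inl 0))
  set Y := b (.inr (.inr 0))
  -- As η ∘ φ = 0, φX lies in the plane of X and Y, and g(φX, X) = 0 with g(X, Y) ≠ 0 removes its
  -- Y-component; likewise for φY. The eigenvalues are opposite by skewness and square to 1.
  have hself (v : TangentSpace I p) : S.metric.inner p (S.phi p v) v = 0 := by
    have := S.inner_phi_left p v v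
    rw [S.metric.symm p v] at this
    linarith
  obtain ⟨a, a', a'', ha⟩ := hexp (S.phi p X)
  obtain ⟨c, c', c'', hc⟩ := hexp (S.phi p Y)
  have ha0 : a = 0 := by simpa [ha, S.eta_xi, hX, hY] using S.eta_phi p X
  have hc0 : c = 0 := by simpa [hc, S.eta_xi, hX, hY] using S.eta_phi p Y
  have ha2 : a'' = 0 := by
    have := hself X
    rw [ha, ha0] at this
    simpa [hXX, S.metric.symm p Y X, hXY] using this
  have hc1 : c' = 0 := by
    have := hself Y
    rw [hc, hc0] at this
    simpa [hYY, hXY] using this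
  have ha' : S.phi p X = a' • X := by rw [ha, ha0, ha2]; simp
  have hc' : S.phi p Y = c'' • Y := by rw [hc, hc0, hc1]; simp
  have hac : c'' = -a' := by
    have := S.inner_phi_left p X Y
    rw [ha', hc'] at this
    simp only [map_smul, _root_.smul_apply, smul_eq_mul] at this
    have h2 : (a' + c'') * S.metric.inner p X Y = 0 := by linarith
    linarith [(mul_eq_zero.1 h2).resolve_right hXY]
  have hsq : a' * a' = 1 := by
    have h1 := S.phi_phi p X
    rw [ha', map_smul, ha', hX, zero_smul, sub_zero, smul_smul] at h1
    have h2 := congrArg (fun v ↦ S.metric.inner p v Y) h1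
    simp only [map_smul, _root_.smul_apply, smul_eq_mul] at h2
    exact mul_right_cancel₀ hXY (by rw [h2, one_mul])
  rw [ha', hc', hac]
  rcases mul_self_eq_one_iff.1 hsq with h | h <;> simp [h]

lemma IsAdaptedBasis.h_eq {p : M} {S : ParacontactMetricStructure I M 1}
    {b : Basis (Unit ⊕ (Fin 1 ⊕ Fin 1)) ℝ (TangentSpace I p)} (hb : S.IsAdaptedBasis p b)
    (hp : S.h p ≠ 0) :
    S.h p (b (.inr (.inl 0))) = b (.inr (.inr 0)) ∧ S.h p (b (.inr (.inr 0))) = 0 := by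
  refine (hb.h_blocks 0).resolve_right fun h ↦ hp ?_
  have : (S.h p).toLinearMap = 0 := by
    refine b.ext ?_
    rintro (k | k | k)
    · rw [show b (.inl k) = S.xi p from hb.xi_eq]
      exact S.h_xi p
    · rw [Subsingleton.elim k 0]
      exact h.1
    · rw [Subsingleton.elim k 0]
      exact h.2
  ext v
  exact congrArg (fun L ↦ L v) this

end ParacontactMetricStructure

end ParacontactGeometry

end

theorem theorem3p2 (n : ℕ) {M : Type*} [TopologicalSpace M] [T2Space M]
    [SecondCountableTopology M] [ChartedSpace (EuclideanSpace ℝ (Fin (2 * n + 1))) M]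
    [IsManifold (𝓡 (2 * n + 1)) ∞ M]
    (S : ParacontactGeometry.ParacontactMetricStructure (𝓡 (2 * n + 1)) M n) (μ : ℝ)
    (hS : S.IsKappaMuSpace (-1) μ) :
    (S.h = 0 ∧ S.IsParaSasakian) ∨
    (S.h ≠ 0 ∧
      (∀ p : M, S.h p ≠ 0 → 1 ≤ S.rankH p ∧ S.rankH p ≤ n) ∧
      (∀ p : M, ∃ b : Module.Basis (Unit ⊕ (Fin n ⊕ Fin n)) ℝ (TangentSpace (𝓡 (2 * n + 1)) p),
        S.IsAdaptedBasis p b) ∧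
      (n = 1 → ∀ (p : M)
        (b : Module.Basis (Unit ⊕ (Fin n ⊕ Fin n)) ℝ (TangentSpace (𝓡 (2 * n + 1)) p)),
        S.IsAdaptedBasis p b → ∀ i : Fin n,
          ((S.phi p (b (.inr (.inl i))) = b (.inr (.inl i)) ∧
              S.phi p (b (.inr (.inr i))) = -b (.inr (.inr i))) ∨
            (S.phi p (b (.inr (.inl i))) = -b (.inr (.inl i)) ∧
              S.phi p (b (.inr (.inr i))) = b (.inr (.inr i)))) ∧
          (S.h p ≠ 0 →
            S.h p (S.xi p) = 0 ∧ S.h p (b (.inr (.inl i))) = b (.inr (.inr i)) ∧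
              S.h p (b (.inr (.inr i))) = 0))) := by
  have hE : Module.finrank ℝ (EuclideanSpace ℝ (Fin (2 * n + 1))) = 2 * n + 1 := by simp
  by_cases hh : S.h = 0
  · exact .inl ⟨hh, hS.isParaSasakian_of_h_eq_zero hh⟩
  have hb := S.exists_isAdaptedBasis hE hS.h_h
  refine .inr ⟨hh, fun p hp ↦ ⟨S.one_le_rankH hp, (hb p).choose_spec.rankH_le⟩, hb, ?_⟩
  rintro rfl p b hb i
  rw [Subsingleton.elim i 0]
  exact ⟨hb.phi_eq, fun hp ↦ ⟨S.h_xi p, hb.h_eq hp⟩⟩
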